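/- All multigraphs are finite, and a multigraph $G=(V,E)$ is called $2$-connected if $|V|\ge 2$, $G$ has no loops, $G$ is connected, and $G$ has no separating vertex (so two vertices joined by one or more parallel edges form a $2$-connected multigraph). For $S\subseteq V$ let $G|_S$ be the induced sub-multigraph and $E(S)$ its edge set. A proper subset $S\subsetneq V$ is a good flat of $G$ if both $G|_S$ and the multigraph obtained from $G$ by contracting $E(S)$ (deleting the edges of $E(S)$ and identifying all vertices of $S$) are $2$-connected. For a positive integer $\delta$, a weight function of $G$ is a function $w\colon E\to\{1,\delta-1\}$ such that $w(e)=1$ whenever $G\setminus e$ is $2$-connected and $w(e)=\delta-1$ whenever $G/e$ is $2$-connected. $G$ satisfies $(\spadesuit)_\delta$ if it has a weight function $w$ with $\sum_{e\in E}w(e)=\delta(|V|-1)$ and $\sum_{e\in E(S)}w(e)+1=\delta(|S|-1)$ for every good flat $S$. (For $\delta=2$ every weight is $1$, so the conditions read $|E|=2(|V|-1)$ and $|E(S)|+1=2(|S|-1)$ for every good flat $S$.) Path construction (for $\delta$): given $2$-connected multigraphs $G_1,G_2$ and edges $e_1=u_1v_1$ of $G_1$ and $e_2=u_2v_2$ of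 $G_2$ with weights $w(e_1)=1$ and $w(e_2)=\delta-1$, take the disjoint union of $G_1$ and $G_2$, identify $u_1$ with $u_2$ and $v_1$ with $v_2$ (the endpoints of each edge being labelled in either order), and delete both $e_1$ and $e_2$. For $\delta=2$ there is no restriction on the edges $e_1,e_2$. Theorem. Let $G$ be a $2$-connected multigraph. Then $G$ satisfies $(\spadesuit)_2$ if and only if $G$ is the $2$-cycle $C_2$ (two vertices joined by exactly two parallel edges) or $G$ can be obtained from $K_4$ by the path construction for $\delta=2$, that is, $G$ belongs, up to isomorphism, to the smallest class of multigraphs that contains $K_4$ and contains every multigraph obtained by the path construction from two members of the class. In particular, every $2$-connected multigraph other than $C_2$ that satisfies $(\spadesuit)_2$ is simple. -/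

import Mathlib

/-!
Finite multigraphs are terms `G : Graph α β` with `G.vertexSet` and `G.edgeSet` finite; parallel
edges and loops are allowed in `Graph α β`.
-/

namespace Graph

universe u v

section Basic

variable {α : Type u} {β : Type v}

/-- `G` is 2-connected: it has at least two vertices and no loop, it is connected, and it has no
separating vertex (removing any one vertex leaves a connected graph). In particular two vertices
joined by one or more parallel edges form a 2-connected multigraph. -/
structure IsTwoConnected (G : Graph α β) : Prop where
  nontrivial : G.vertexSet.Nontrivial
  loopless : G.Loopless
  connected : G.toSimpleGraph.Connected
  connected_deleteVerts : ∀ x ∈ G.vertexSet, (G.deleteVerts {x}).toSimpleGraph.Connected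

open Classical in
/-- The map identifying all vertices of `S` to the single new vertex `none`. -/
noncomputable def collapse (S : Set α) (x : α) : Option α :=
  if x ∈ S then none else some x

/-- `E(S)`: the set of edges of `G` with both endpoints in `S`. -/
def edgesWithin (G : Graph α β) (S : Set α) : Set β :=
  {e | ∃ x y, G.IsLink e x y ∧ x ∈ S ∧ y ∈ S}

/-- The contraction `G / e` of an edge: delete `e` and identify its endpoints (edges parallel to
`e` become loops). -/
noncomputable def contractEdge (G : Graph α β) (e : β) : Graph (Option α) β :=
  (G.deleteEdges {e}).map (collapse {x | G.Inc e x})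

/-- The contraction of `E(S)` in `G`, for a set `S` of vertices with `G.induce S` connected:
delete the edges of `E(S)` and identify the vertices of `S`. -/
noncomputable def contractSet (G : Graph α β) (S : Set α) : Graph (Option α) β :=
  (G.deleteEdges (G.edgesWithin S)).map (collapse S)

/-- `S ⊊ V` is a good flat of `G`: both the restriction of `G` to `S` and the contraction of
`E(S)` in `G` are 2-connected. -/
def IsGoodFlat (G : Graph α β) (S : Set α) : Prop :=
  S ⊂ G.vertexSet ∧ (G.induce S).IsTwoConnected ∧ (G.contractSet S).IsTwoConnected

/-- `w` is a weight function `E → {1, δ - 1}` of `G`: it has the value `1` on `e` if `G \ e` is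
2-connected and the value `δ - 1` if `G / e` is 2-connected. (Values of `w` off the edge set are
irrelevant.) -/
def IsWeight (δ : ℕ) (G : Graph α β) (w : β → ℕ) : Prop :=
  ∀ e ∈ G.edgeSet, (w e = 1 ∨ w e = δ - 1) ∧
    ((G.deleteEdges {e}).IsTwoConnected → w e = 1) ∧
    ((G.contractEdge e).IsTwoConnected → w e = δ - 1)

/-- The equalities `(♠)_δ`: `G` possesses a weight function `w` with
`w(E) = δ (|V| - 1)` and `w(E(S)) + 1 = δ (|S| - 1)` for every good flat `S`. -/
def Spade (δ : ℕ) (G : Graph α β) : Prop :=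
  ∃ w : β → ℕ, IsWeight δ G w ∧
    (∑ᶠ e ∈ G.edgeSet, w e) = δ * (G.vertexSet.ncard - 1) ∧
    ∀ S : Set α, G.IsGoodFlat S →
      (∑ᶠ e ∈ G.edgesWithin S, w e) + 1 = δ * (S.ncard - 1)

/-- `G` is a 2-cycle `C_2`: two vertices joined by exactly two parallel edges. -/
def IsTwoCycle (G : Graph α β) : Prop :=
  ∃ x y : α, x ≠ y ∧ ∃ F : Set β, F.ncard = 2 ∧ G = banana x y F

/-- `G` is a clique `K_4`: simple with four vertices, any two of which are adjacent. -/
def IsCompleteFour (G : Graph α β) : Prop :=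
  G.Simple ∧ G.vertexSet.ncard = 4 ∧
    ∀ x ∈ G.vertexSet, ∀ y ∈ G.vertexSet, x ≠ y → G.Adj x y

end Basic

section Gluing

variable {α₁ α₂ α : Type u} {β₁ β₂ β : Type v}

/-- Data exhibiting `G` (up to isomorphism) as the result of gluing `G₁` and `G₂` along the edges
`e₁` and `e₂` and deleting the glued edge: disjoint copies of `G₁` and `G₂` are taken, the
endpoints `u₁, v₁` of `e₁` are identified with the endpoints `u₂, v₂` of `e₂` (in either of the
two possible ways), and neither `e₁` nor `e₂` is kept. -/
structure EdgeGluing (G₁ : Graph α₁ β₁) (e₁ : β₁) (G₂ : Graph α₂ β₂) (e₂ : β₂)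
    (G : Graph α β) where
  (u₁ v₁ : α₁)
  (u₂ v₂ : α₂)
  isLink₁ : G₁.IsLink e₁ u₁ v₁
  isLink₂ : G₂.IsLink e₂ u₂ v₂
  /-- the maps of vertices into the glued graph -/
  (φ₁ : α₁ → α)
  (φ₂ : α₂ → α)
  injOn_φ₁ : Set.InjOn φ₁ G₁.vertexSet
  injOn_φ₂ : Set.InjOn φ₂ G₂.vertexSet
  glue_u : φ₁ u₁ = φ₂ u₂
  glue_v : φ₁ v₁ = φ₂ v₂
  vertexSet_inter : φ₁ '' G₁.vertexSet ∩ φ₂ '' G₂.vertexSet = {φ₁ u₁, φ₁ v₁}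
  vertexSet_eq : G.vertexSet = φ₁ '' G₁.vertexSet ∪ φ₂ '' G₂.vertexSet
  /-- the maps of the remaining edges into the glued graph -/
  (ψ₁ : β₁ → β)
  (ψ₂ : β₂ → β)
  injOn_ψ₁ : Set.InjOn ψ₁ (G₁.edgeSet \ {e₁})
  injOn_ψ₂ : Set.InjOn ψ₂ (G₂.edgeSet \ {e₂})
  edgeSet_disjoint : Disjoint (ψ₁ '' (G₁.edgeSet \ {e₁})) (ψ₂ '' (G₂.edgeSet \ {e₂}))
  edgeSet_eq : G.edgeSet = ψ₁ '' (G₁.edgeSet \ {e₁}) ∪ ψ₂ '' (G₂.edgeSet \ {e₂})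
  map_isLink₁ : ∀ e ∈ G₁.edgeSet \ {e₁}, ∀ x y, G₁.IsLink e x y → G.IsLink (ψ₁ e) (φ₁ x) (φ₁ y)
  map_isLink₂ : ∀ e ∈ G₂.edgeSet \ {e₂}, ∀ x y, G₂.IsLink e x y → G.IsLink (ψ₂ e) (φ₂ x) (φ₂ y)

/-- `G` arises from the 2-connected multigraphs `G₁`, `G₂` by gluing them along an edge `e₁` of
`G₁` of weight `1` and an edge `e₂` of `G₂` of weight `δ - 1`, and deleting the glued edge. -/
def IsPathCon (δ : ℕ) (G₁ : Graph α₁ β₁) (G₂ : Graph α₂ β₂) (G : Graph α β) : Prop :=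
  G₁.IsTwoConnected ∧ G₂.IsTwoConnected ∧
    ∃ e₁ ∈ G₁.edgeSet, ∃ e₂ ∈ G₂.edgeSet,
      (∃ w₁, IsWeight δ G₁ w₁ ∧ w₁ e₁ = 1) ∧
      (∃ w₂, IsWeight δ G₂ w₂ ∧ w₂ e₂ = δ - 1) ∧
      Nonempty (EdgeGluing G₁ e₁ G₂ e₂ G)

end Gluing

/-- `G` can be obtained from (copies of) the clique `K_4` by finitely many, possibly zero,
applications of the construction `IsPathCon δ` to graphs already obtained. -/
inductive ObtainedFromCompleteFour (δ : ℕ) :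
    ∀ {α : Type u} {β : Type v}, Graph α β → Prop where
  | base {α : Type u} {β : Type v} {G : Graph α β} (h : G.IsCompleteFour) :
      ObtainedFromCompleteFour δ G
  | step {α₁ α₂ α : Type u} {β₁ β₂ β : Type v} {G₁ : Graph α₁ β₁} {G₂ : Graph α₂ β₂}
      {G : Graph α β} (h₁ : ObtainedFromCompleteFour δ G₁) (h₂ : ObtainedFromCompleteFour δ G₂)
      (h : IsPathCon δ G₁ G₂ G) : ObtainedFromCompleteFour δ G

end Graph

/-!
For `δ = 2` every weight is `1`. Write `i(S)` for the number of edges inside `S`. In a 2-connected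
graph a proper subset `S` of the vertices is a good flat exactly if it induces a 2-connected graph
and its complement is connected (`Graph.isGoodFlat_iff`), so the equalities become conditions
`|E| = 2 (|V| - 1)` and `i(S) = 2 |S| - 3` on vertex sets (`Graph.UnitSpade`,
`Graph.spade_two_iff`). Connectivity of a vertex set is handled through predicates closed under
adjacency (`Graph.ConnOn`).

*Sparsity.* The equalities imply `i(S) ≤ 2 |S| - 3` for every proper subset `S` with at least two
vertices (`Graph.UnitSpade.ncard_edgesWithin_le`). Since `i` is modular on pairs of sets without
edges between their differences, a violating set with disconnected complement can be enlarged, and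
one with connected complement that is not itself 2-connected contains a smaller violating set with
connected complement. In the end there would be a violating good flat.

*Decomposition.* If no two vertices separate `G` and `|V| ≥ 3`, then the complement of each vertex
is a good flat; thus `G` is cubic, `3 |V| = 4 (|V| - 1)`, and `G` is `K_4`
(`Graph.UnitSpade.isCompleteFour`). Otherwise `V = A ∪ B` with `A ∩ B = {u, v}` separating. The
sparsity bounds for `A` and `B` add up to exactly `|E|`, so they are attained and `u`, `v` are not
adjacent. Hence `G` is the gluing of `G[A] + uv` and `G[B] + uv`, and the good flats of a side
correspond to good flats of `G`: a good flat of `G[A] + uv` other than `{u, v}` that contains both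
`u` and `v` is completed by `B`, one missing `u` or `v` is kept
(`Graph.EdgeGluing.unitSpade_part₁`). Induction on `|V|` gives
`Graph.UnitSpade.obtainedFromCompleteFour`.

*Composition.* Conversely, a good flat of a gluing either contains one side, since its complement
is connected, or misses a glued vertex and lies on one side, since it is 2-connected. So its
equality follows from the equalities for the parts (`Graph.EdgeGluing.unitSpade`), and `K_4` is
checked directly (`Graph.IsCompleteFour.finite_unitSpade`). Simplicity is the sparsity bound for
two vertices.
-/

namespace Graph

universe u v

/-! ### 2-connectivity and good flats in terms of vertex sets -/

section ConnOn

variable {α α' : Type*} {R R' : α → α → Prop} {X : Set α}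

/-- The set `X` is nonempty and connected under the relation `R`. For symmetric `R` this says that
any two elements of `X` are joined by an `R`-path inside `X`; it is encoded by the absence of
nontrivial predicates on `X` that are closed under `R`. -/
def ConnOn (R : α → α → Prop) (X : Set α) : Prop :=
  X.Nonempty ∧ ∀ P : α → Prop, (∀ x ∈ X, ∀ y ∈ X, R x y → P x → P y) →
    (∃ x ∈ X, P x) → ∀ x ∈ X, P x

/-- The relation `R` restricted to `X` is 2-connected: `X` has two elements, is connected, and
remains connected when an element is removed. -/
def TwoConnOn (R : α → α → Prop) (X : Set α) : Prop :=
  X.Nontrivial ∧ ConnOn R X ∧ ∀ x ∈ X, ConnOn R (X \ {x})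

lemma ConnOn.mono (h : ConnOn R X) (hR : ∀ x ∈ X, ∀ y ∈ X, R x y → R' x y) : ConnOn R' X :=
  ⟨h.1, fun P hP ↦ h.2 P fun x hx y hy hxy ↦ hP x hx y hy (hR x hx y hy hxy)⟩

lemma TwoConnOn.mono (h : TwoConnOn R X) (hR : ∀ x ∈ X, ∀ y ∈ X, R x y → R' x y) :
    TwoConnOn R' X :=
  ⟨h.1, h.2.1.mono hR, fun x hx ↦ (h.2.2 x hx).mono fun y hy z hz ↦ hR y hy.1 z hz.1⟩

lemma TwoConnOn.connOn_diff_of_subsingleton (h : TwoConnOn R X) {Z : Set α}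
    (hZ : Z.Subsingleton) (hZX : Z ⊆ X) : ConnOn R (X \ Z) := by
  obtain rfl | ⟨x, rfl⟩ := hZ.eq_empty_or_singleton
  · simpa using h.2.1
  · exact h.2.2 x (hZX rfl)

lemma ConnOn.image {S : α' → α' → Prop} {f : α → α'} (h : ConnOn R X)
    (hf : ∀ x ∈ X, ∀ y ∈ X, R x y → f x = f y ∨ S (f x) (f y)) : ConnOn S (f '' X) := by
  refine ⟨h.1.image f, ?_⟩
  rintro P hP ⟨_, ⟨x, hx, rfl⟩, hPx⟩ _ ⟨y, hy, rfl⟩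
  refine h.2 (fun z ↦ P (f z)) (fun a ha b hb hab hPa ↦ ?_) ⟨x, hx, hPx⟩ y hy
  obtain he | hS := hf a ha b hb hab
  · exact he ▸ hPa
  · exact hP _ ⟨a, ha, rfl⟩ _ ⟨b, hb, rfl⟩ hS hPa

lemma ConnOn.of_image {S : α' → α' → Prop} {f : α → α'} (h : ConnOn S (f '' X))
    (hinj : Set.InjOn f X) (hf : ∀ x ∈ X, ∀ y ∈ X, S (f x) (f y) → R x y) : ConnOn R X := by
  refine ⟨h.1.of_image, fun P hP ⟨x, hx, hPx⟩ y hy ↦ ?_⟩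
  obtain ⟨z, hz, hzy, hPz⟩ := h.2 (fun a ↦ ∃ z ∈ X, f z = a ∧ P z) (by
    rintro _ ⟨a, ha, rfl⟩ _ ⟨b, hb, rfl⟩ hab ⟨z, hz, hza, hPz⟩
    obtain rfl := hinj hz ha hza
    exact ⟨b, hb, rfl, hP z hz b hb (hf _ hz _ hb hab) hPz⟩) ⟨f x, ⟨x, hx, rfl⟩, x, hx, rfl, hPx⟩
    (f y) ⟨y, hy, rfl⟩
  exact hinj hz hy hzy ▸ hPz

lemma connOn_image_iff {S : α' → α' → Prop} {f : α → α'}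
    (hinj : Set.InjOn f X) (hf : ∀ x ∈ X, ∀ y ∈ X, R x y ↔ S (f x) (f y)) :
    ConnOn S (f '' X) ↔ ConnOn R X :=
  ⟨fun h ↦ h.of_image hinj fun x hx y hy ↦ (hf x hx y hy).2,
    fun h ↦ h.image fun x hx y hy hxy ↦ .inr ((hf x hx y hy).1 hxy)⟩

lemma twoConnOn_image_iff {S : α' → α' → Prop} {f : α → α'}
    (hinj : Set.InjOn f X) (hf : ∀ x ∈ X, ∀ y ∈ X, R x y ↔ S (f x) (f y)) :
    TwoConnOn S (f '' X) ↔ TwoConnOn R X := by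
  have key : ∀ x ∈ X, f '' X \ {f x} = f '' (X \ {x}) := fun x hx ↦ by
    rw [← Set.image_singleton, hinj.image_sdiff_subset (by simpa using hx)]
  unfold TwoConnOn
  have hnt : (f '' X).Nontrivial ↔ X.Nontrivial :=
    ⟨Set.nontrivial_of_image f X, fun h ↦ h.image_of_injOn hinj⟩
  rw [connOn_image_iff hinj hf, Set.forall_mem_image, hnt]
  refine and_congr_right fun _ ↦ and_congr_right fun _ ↦ forall₂_congr fun x hx ↦ ?_
  rw [key x hx]
  exact connOn_image_iff (hinj.mono Set.sdiff_subset) fun a ha b hb ↦ hf a ha.1 b hb.1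

end ConnOn

section TwoConnected

variable {α : Type u} {β : Type v} {G : Graph α β} {S : Set α}

lemma toSimpleGraph_connected_iff (G : Graph α β) :
    G.toSimpleGraph.Connected ↔ ConnOn G.Adj G.vertexSet := by
  constructor
  · intro h
    obtain ⟨⟨x₀, hx₀⟩⟩ := h.nonempty
    refine ⟨⟨x₀, hx₀⟩, fun P hP ⟨x, hx, hPx⟩ y hy ↦ ?_⟩
    obtain ⟨p⟩ := h.preconnected ⟨x, hx⟩ ⟨y, hy⟩
    suffices ∀ (a b : G.vertexSet), G.toSimpleGraph.Walk a b → P a → P b from this _ _ p hPx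
    intro a b p
    induction p with
    | nil => exact id
    | cons h _ ih => exact fun ha ↦ ih (hP _ (Subtype.prop _) _ (Subtype.prop _) h.2 ha)
  · rintro ⟨⟨x, hx⟩, h⟩
    have key : ∀ y (hy : y ∈ G.vertexSet), G.toSimpleGraph.Reachable ⟨x, hx⟩ ⟨y, hy⟩ := by
      have := h (fun y ↦ ∃ hy : y ∈ G.vertexSet, G.toSimpleGraph.Reachable ⟨x, hx⟩ ⟨y, hy⟩) ?_
        ⟨x, hx, hx, .rfl⟩
      · exact fun y hy ↦ (this y hy).2
      rintro a ha b hb hab ⟨_, hr⟩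
      refine ⟨hb, ?_⟩
      obtain rfl | hne := eq_or_ne a b
      · exact hr
      · exact hr.trans (SimpleGraph.Adj.reachable ⟨by simpa using hne, hab⟩)
    have : Nonempty G.vertexSet := ⟨⟨x, hx⟩⟩
    exact ⟨fun a b ↦ (key a.1 a.2).symm.trans (key b.1 b.2)⟩

lemma connOn_induce_iff {X Y : Set α} (hXY : X ⊆ Y) :
    ConnOn (G.induce Y).Adj X ↔ ConnOn G.Adj X :=
  ⟨fun h ↦ h.mono fun _ _ _ _ ⟨e, he⟩ ↦ ⟨e, he.1⟩,
    fun h ↦ h.mono fun _ hx _ hy ⟨e, he⟩ ↦ ⟨e, he, hXY hx, hXY hy⟩⟩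

lemma isTwoConnected_iff :
    G.IsTwoConnected ↔ G.Loopless ∧ TwoConnOn G.Adj G.vertexSet := by
  have key : ∀ x, (G.deleteVerts {x}).toSimpleGraph.Connected ↔
      ConnOn G.Adj (G.vertexSet \ {x}) := fun x ↦ by
    rw [toSimpleGraph_connected_iff, vertexSet_deleteVerts, deleteVerts,
      connOn_induce_iff subset_rfl]
  constructor
  · rintro ⟨h1, h2, h3, h4⟩
    exact ⟨h2, h1, (toSimpleGraph_connected_iff G).1 h3, fun x hx ↦ (key x).1 (h4 x hx)⟩
  · rintro ⟨h2, h1, h3, h4⟩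
    exact ⟨h1, h2, (toSimpleGraph_connected_iff G).2 h3, fun x hx ↦ (key x).2 (h4 x hx)⟩

lemma induce_isTwoConnected_iff (hG : G.Loopless) :
    (G.induce S).IsTwoConnected ↔ TwoConnOn G.Adj S := by
  rw [isTwoConnected_iff]
  have hl : (G.induce S).Loopless := ⟨fun e x h ↦ hG.not_isLoopAt e x h.1⟩
  refine (and_iff_right hl).trans
    ⟨fun h ↦ h.mono fun _ _ _ _ ⟨e, he⟩ ↦ ⟨e, he.1⟩,
      fun h ↦ h.mono fun _ hx _ hy ⟨e, he⟩ ↦ ⟨e, he, hx, hy⟩⟩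

lemma contractSet_adj_iff {a b : Option α} :
    (G.contractSet S).Adj a b ↔
      ∃ x y, G.Adj x y ∧ ¬ (x ∈ S ∧ y ∈ S) ∧ collapse S x = a ∧ collapse S y = b := by
  constructor
  · rintro ⟨e, x, y, h, rfl, rfl⟩
    simp only [deleteEdges_isLink] at h
    exact ⟨x, y, ⟨e, h.1⟩, fun hS ↦ h.2 ⟨x, y, h.1, hS⟩, rfl, rfl⟩
  · rintro ⟨x, y, ⟨e, he⟩, hS, rfl, rfl⟩
    refine ⟨e, x, y, ?_, rfl, rfl⟩
    simp only [deleteEdges_isLink]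
    refine ⟨he, fun ⟨x', y', h', hx', hy'⟩ ↦ hS ?_⟩
    obtain ⟨rfl, rfl⟩ | ⟨rfl, rfl⟩ := he.eq_and_eq_or_eq_and_eq h'
    · exact ⟨hx', hy'⟩
    · exact ⟨hy', hx'⟩

/-- Contracting `S` in a 2-connected graph leaves a 2-connected graph exactly if the complement
of `S` is connected: the contracted vertex is the only one that could separate. -/
lemma contractSet_isTwoConnected_iff (hG : G.IsTwoConnected) (hS : S ⊂ G.vertexSet)
    (hne : S.Nonempty) :
    (G.contractSet S).IsTwoConnected ↔ ConnOn G.Adj (G.vertexSet \ S) := by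
  obtain ⟨hl, hnt, hc, hc'⟩ := isTwoConnected_iff.1 hG
  obtain ⟨s, hs⟩ := hne
  obtain ⟨t, htV, htS⟩ := Set.exists_of_ssubset hS
  have hV : (G.contractSet S).vertexSet = collapse S '' G.vertexSet := rfl
  have hmem : ∀ x ∈ S, collapse S x = none := fun x hx ↦ by simp [collapse, hx]
  have hnot : ∀ x ∉ S, collapse S x = some x := fun x hx ↦ by simp [collapse, hx]
  have hnone : ∀ x, collapse S x = none ↔ x ∈ S := fun x ↦ by simp [collapse]
  have hsome : ∀ x y, collapse S x = some y ↔ x ∉ S ∧ x = y := fun x y ↦ by simp [collapse]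
  have hmap : ∀ x y, G.Adj x y →
      collapse S x = collapse S y ∨ (G.contractSet S).Adj (collapse S x) (collapse S y) := by
    intro x y hxy
    by_cases h : x ∈ S ∧ y ∈ S
    · exact .inl (by rw [hmem x h.1, hmem y h.2])
    · exact .inr (contractSet_adj_iff.2 ⟨x, y, hxy, h, rfl, rfl⟩)
  have hVnone : collapse S '' G.vertexSet \ {none} = some '' (G.vertexSet \ S) := by
    ext a
    cases a with
    | none => simp
    | some a => simp [hsome]
  have hiff : ConnOn (G.contractSet S).Adj (some '' (G.vertexSet \ S)) ↔
      ConnOn G.Adj (G.vertexSet \ S) := by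
    refine connOn_image_iff (Option.some_injective _).injOn fun x hx y hy ↦ ?_
    rw [contractSet_adj_iff]
    constructor
    · exact fun h ↦ ⟨x, y, h, fun h ↦ hx.2 h.1, hnot x hx.2, hnot y hy.2⟩
    · rintro ⟨x', y', h, -, hx', hy'⟩
      obtain ⟨-, rfl⟩ := (hsome _ _).1 hx'
      obtain ⟨-, rfl⟩ := (hsome _ _).1 hy'
      exact h
  rw [isTwoConnected_iff, hV]
  constructor
  · rintro ⟨-, -, -, h⟩
    rw [← hiff, ← hVnone]
    exact h none ⟨s, hS.1 hs, hmem s hs⟩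
  · intro h
    refine ⟨⟨fun e a ha ↦ ?_⟩, ⟨none, ⟨s, hS.1 hs, hmem s hs⟩, some t, ⟨t, htV, hnot t htS⟩,
      by simp⟩, hc.image fun x _ y _ ↦ hmap x y, ?_⟩
    · obtain ⟨x, y, hxy, hxS, hx, hy⟩ := contractSet_adj_iff.1 ⟨e, ha⟩
      cases a with
      | none => exact hxS ⟨(hnone x).1 hx, (hnone y).1 hy⟩
      | some a =>
        obtain ⟨-, rfl⟩ := (hsome _ _).1 hx
        obtain ⟨-, rfl⟩ := (hsome _ _).1 hy
        exact G.not_adj_self _ hxy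
    · rintro _ ⟨x, hx, rfl⟩
      by_cases hxS : x ∈ S
      · rwa [hmem x hxS, hVnone, hiff]
      · have : collapse S '' G.vertexSet \ {collapse S x} = collapse S '' (G.vertexSet \ {x}) := by
          rw [hnot x hxS]
          ext a
          cases a with
          | none =>
            simp only [Set.mem_sdiff, Set.mem_image, hnone, Set.mem_singleton_iff]
            exact ⟨fun ⟨⟨z, hz, hzS⟩, _⟩ ↦ ⟨z, ⟨hz, fun h ↦ hxS (h ▸ hzS)⟩, hzS⟩,
              fun ⟨z, hz, hzS⟩ ↦ ⟨⟨z, hz.1, hzS⟩, by simp⟩⟩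
          | some a =>
            simp only [Set.mem_sdiff, Set.mem_image, hsome, Set.mem_singleton_iff]
            constructor
            · rintro ⟨⟨z, hz, hzS, rfl⟩, hne⟩
              exact ⟨z, ⟨hz, fun h ↦ hne (by rw [h])⟩, hzS, rfl⟩
            · rintro ⟨z, hz, hzS, rfl⟩
              exact ⟨⟨z, hz.1, hzS, rfl⟩, fun h ↦ hz.2 (Option.some_injective _ h)⟩
        rw [this]
        exact (hc' x hx).image fun x _ y _ ↦ hmap x y

lemma isGoodFlat_iff (hG : G.IsTwoConnected) :
    G.IsGoodFlat S ↔
      S ⊂ G.vertexSet ∧ TwoConnOn G.Adj S ∧ ConnOn G.Adj (G.vertexSet \ S) := by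
  unfold IsGoodFlat
  rw [induce_isTwoConnected_iff hG.loopless]
  exact and_congr_right fun h ↦ and_congr_right fun h' ↦
    contractSet_isTwoConnected_iff hG h h'.1.nonempty

/-- The equalities `(♠)_2` with all weights equal to `1` and good flats expressed by
connectivity inside `G`. -/
def UnitSpade (G : Graph α β) : Prop :=
  G.edgeSet.ncard = 2 * (G.vertexSet.ncard - 1) ∧
    ∀ S ⊂ G.vertexSet, TwoConnOn G.Adj S → ConnOn G.Adj (G.vertexSet \ S) →
      (G.edgesWithin S).ncard + 1 = 2 * (S.ncard - 1)

lemma edgesWithin_subset (G : Graph α β) (S : Set α) : G.edgesWithin S ⊆ G.edgeSet :=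
  fun _ ⟨_, _, h, _⟩ ↦ h.edge_mem

lemma finsum_mem_eq_ncard {E : Set β} {w : β → ℕ} (hw : ∀ e ∈ E, w e = 1)
    (hE : E.Finite) : ∑ᶠ e ∈ E, w e = E.ncard := by
  rw [finsum_mem_eq_finite_toFinset_sum _ hE, Finset.sum_congr rfl (g := fun _ ↦ 1)
    (fun e he ↦ hw e (by simpa using he)), Set.ncard_eq_toFinset_card E hE]
  simp

lemma spade_two_iff (hG : G.IsTwoConnected) (hE : G.edgeSet.Finite) :
    G.Spade 2 ↔ G.UnitSpade := by
  constructor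
  · rintro ⟨w, hw, h1, h2⟩
    have hw1 : ∀ e ∈ G.edgeSet, w e = 1 := fun e he ↦ by simpa using (hw e he).1
    refine ⟨by rw [← h1, finsum_mem_eq_ncard hw1 hE], fun S hS hS1 hS2 ↦ ?_⟩
    rw [← h2 S ((isGoodFlat_iff hG).2 ⟨hS, hS1, hS2⟩), finsum_mem_eq_ncard
      (fun e he ↦ hw1 e (G.edgesWithin_subset S he)) (hE.subset (G.edgesWithin_subset S))]
  · rintro ⟨h1, h2⟩
    refine ⟨fun _ ↦ 1, fun e _ ↦ ⟨.inl rfl, fun _ ↦ rfl, fun _ ↦ rfl⟩, ?_, fun S hS ↦ ?_⟩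
    · rw [finsum_mem_eq_ncard (fun _ _ ↦ rfl) hE, h1]
    · obtain ⟨hS, hS1, hS2⟩ := (isGoodFlat_iff hG).1 hS
      rw [finsum_mem_eq_ncard (fun _ _ ↦ rfl) (hE.subset (G.edgesWithin_subset S)),
        h2 S hS hS1 hS2]

end TwoConnected

/-! ### The sparsity bound -/

section Bound

variable {α : Type u} {β : Type v} {G : Graph α β}

lemma edgesWithin_mono {S T : Set α} (h : S ⊆ T) : G.edgesWithin S ⊆ G.edgesWithin T :=
  fun _ ⟨x, y, he, hx, hy⟩ ↦ ⟨x, y, he, h hx, h hy⟩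

lemma edgesWithin_vertexSet : G.edgesWithin G.vertexSet = G.edgeSet := by
  refine (G.edgesWithin_subset _).antisymm fun e he ↦ ?_
  obtain ⟨x, y, h⟩ := exists_isLink_of_mem_edgeSet he
  exact ⟨x, y, h, h.left_mem, h.right_mem⟩

lemma edgesWithin_eq_empty_of_subsingleton (hl : G.Loopless) {S : Set α}
    (hS : S.Subsingleton) : G.edgesWithin S = ∅ := by
  rw [Set.eq_empty_iff_forall_notMem]
  rintro e ⟨x, y, he, hx, hy⟩
  obtain rfl := hS hx hy
  exact hl.not_isLoopAt e x he

lemma IsLink.mem_edgesWithin_iff {e : β} {x y : α} (h : G.IsLink e x y) {S : Set α} :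
    e ∈ G.edgesWithin S ↔ x ∈ S ∧ y ∈ S := by
  refine ⟨?_, fun hS ↦ ⟨x, y, h, hS.1, hS.2⟩⟩
  rintro ⟨x', y', h', hx, hy⟩
  obtain ⟨rfl, rfl⟩ | ⟨rfl, rfl⟩ := h.eq_and_eq_or_eq_and_eq h'
  · exact ⟨hx, hy⟩
  · exact ⟨hy, hx⟩

lemma edgesWithin_inter (X Y : Set α) :
    G.edgesWithin (X ∩ Y) = G.edgesWithin X ∩ G.edgesWithin Y := by
  ext e
  by_cases he : e ∈ G.edgeSet
  · obtain ⟨x, y, h⟩ := exists_isLink_of_mem_edgeSet he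
    simp only [Set.mem_inter_iff, h.mem_edgesWithin_iff]
    tauto
  · exact iff_of_false (fun h ↦ he (G.edgesWithin_subset _ h))
      fun h ↦ he (G.edgesWithin_subset _ h.1)

/-- The edge count is modular on pairs of vertex sets without edges between their differences. -/
lemma ncard_edgesWithin_add (hE : G.edgeSet.Finite) {X Y : Set α}
    (h : ∀ x ∈ X, x ∉ Y → ∀ y ∈ Y, y ∉ X → ¬ G.Adj x y) :
    (G.edgesWithin X).ncard + (G.edgesWithin Y).ncard =
      (G.edgesWithin (X ∪ Y)).ncard + (G.edgesWithin (X ∩ Y)).ncard := by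
  have hU : G.edgesWithin (X ∪ Y) = G.edgesWithin X ∪ G.edgesWithin Y := by
    refine subset_antisymm ?_ (Set.union_subset (edgesWithin_mono Set.subset_union_left)
      (edgesWithin_mono Set.subset_union_right))
    rintro e ⟨x, y, he, hx, hy⟩
    rw [Set.mem_union, he.mem_edgesWithin_iff, he.mem_edgesWithin_iff]
    have h1 := fun a b c d ↦ h x a b y c d he.adj
    have h2 := fun a b c d ↦ h y a b x c d he.symm.adj
    simp only [Set.mem_union] at hx hy
    tauto
  rw [hU, edgesWithin_inter, Set.ncard_union_add_ncard_inter _ _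
    (hE.subset (G.edgesWithin_subset _)) (hE.subset (G.edgesWithin_subset _))]

/-- If `S` violates the sparsity bound and its complement is disconnected, then a larger proper
subset violates the bound. -/
lemma exists_larger_dense (hV : G.vertexSet.Finite) (hE : G.edgeSet.Finite)
    (hcard : G.edgeSet.ncard = 2 * (G.vertexSet.ncard - 1)) {S : Set α} (hS : S ⊂ G.vertexSet)
    (hd : 2 * S.ncard ≤ (G.edgesWithin S).ncard + 2)
    (hc : ¬ ConnOn G.Adj (G.vertexSet \ S)) :
    ∃ T ⊂ G.vertexSet, S.ncard < T.ncard ∧ 2 * T.ncard ≤ (G.edgesWithin T).ncard + 2 := by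
  obtain ⟨t, htV, htS⟩ := Set.exists_of_ssubset hS
  obtain ⟨P, hP, ⟨a, ha, hPa⟩, b, hb, hPb⟩ : ∃ P : α → Prop,
      (∀ x ∈ G.vertexSet \ S, ∀ y ∈ G.vertexSet \ S, G.Adj x y → P x → P y) ∧
      (∃ x ∈ G.vertexSet \ S, P x) ∧ ∃ y ∈ G.vertexSet \ S, ¬ P y := by
    by_contra! hcon
    exact hc ⟨⟨t, htV, htS⟩, fun P hP hx y hy ↦ hcon P hP hx y hy⟩
  set X := S ∪ {x ∈ G.vertexSet | P x} with hX
  set Y := S ∪ {x ∈ G.vertexSet | ¬ P x} with hY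
  have hXV : X ⊂ G.vertexSet := by
    refine ⟨Set.union_subset hS.1 fun x hx ↦ hx.1, fun h ↦ ?_⟩
    obtain h | h := h hb.1
    exacts [hb.2 h, hPb h.2]
  have hYV : Y ⊂ G.vertexSet := by
    refine ⟨Set.union_subset hS.1 fun x hx ↦ hx.1, fun h ↦ ?_⟩
    obtain h | h := h ha.1
    exacts [ha.2 h, h.2 hPa]
  have hXY : X ∪ Y = G.vertexSet := by
    refine subset_antisymm (Set.union_subset hXV.1 hYV.1) fun x hx ↦ ?_
    by_cases hPx : P x
    · exact .inl (.inr ⟨hx, hPx⟩)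
    · exact .inr (.inr ⟨hx, hPx⟩)
  have hXiY : X ∩ Y = S := by
    ext x
    simp only [hX, hY, Set.mem_inter_iff, Set.mem_union, Set.mem_ofPred_eq]
    tauto
  have hSX : S.ncard < X.ncard := Set.ncard_lt_ncard
    ⟨Set.subset_union_left, fun h ↦ ha.2 (h (.inr ⟨ha.1, hPa⟩))⟩ (hV.subset hXV.1)
  have hSY : S.ncard < Y.ncard := Set.ncard_lt_ncard
    ⟨Set.subset_union_left, fun h ↦ hb.2 (h (.inr ⟨hb.1, hPb⟩))⟩ (hV.subset hYV.1)
  have hi := ncard_edgesWithin_add (X := X) (Y := Y) hE (by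
    intro x hx hxY y hy hyX hxy
    have hxS : x ∉ S := fun h ↦ hxY (.inl h)
    have hyS : y ∉ S := fun h ↦ hyX (.inl h)
    exact (hy.resolve_left hyS).2
      (hP x ⟨hXV.1 hx, hxS⟩ y ⟨hYV.1 hy, hyS⟩ hxy (hx.resolve_left hxS).2))
  have hn := Set.ncard_union_add_ncard_inter X Y (hV.subset hXV.1) (hV.subset hYV.1)
  rw [hXY, hXiY] at hi hn
  rw [edgesWithin_vertexSet, hcard] at hi
  by_cases hdX : 2 * X.ncard ≤ (G.edgesWithin X).ncard + 2
  · exact ⟨X, hXV, hSX, hdX⟩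
  · exact ⟨Y, hYV, hSY, by omega⟩

/-- Suppose `S` violates the sparsity bound, has connected complement, and splits along a set `Z`
of at most one vertex. Then a smaller set with connected complement violates the bound: a
component cut off from the complement would be separated from the rest of `G` by `Z`. -/
lemma exists_smaller_dense (hV : G.vertexSet.Finite) (hE : G.edgeSet.Finite)
    (hG : G.IsTwoConnected) {S Z : Set α} (hS : S ⊂ G.vertexSet)
    (h2 : 2 ≤ S.ncard) (hd : 2 * S.ncard ≤ (G.edgesWithin S).ncard + 2)
    (hc : ConnOn G.Adj (G.vertexSet \ S)) (hZ : Z.Subsingleton) (hZS : Z ⊆ S)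
    (hn : ¬ ConnOn G.Adj (S \ Z)) :
    ∃ T ⊂ G.vertexSet, T.ncard < S.ncard ∧ 2 ≤ T.ncard ∧
      2 * T.ncard ≤ (G.edgesWithin T).ncard + 2 ∧ ConnOn G.Adj (G.vertexSet \ T) := by
  obtain ⟨hl, hG2⟩ := isTwoConnected_iff.1 hG
  have hSf : S.Finite := hV.subset hS.1
  have hZ1 : Z.ncard ≤ 1 := (Set.ncard_le_one (hSf.subset hZS)).2 hZ
  have hSZ : (S \ Z).Nonempty := by
    rw [Set.nonempty_iff_ne_empty]
    intro h
    have := Set.ncard_le_ncard (Set.sdiff_eq_empty.1 h) (hSf.subset hZS)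
    omega
  -- The complement of any closed part of `S \ Z` is connected.
  have key : ∀ P : α → Prop, (∀ x ∈ S \ Z, ∀ y ∈ S \ Z, G.Adj x y → (P x ↔ P y)) →
      (∃ x ∈ S \ Z, P x) → (∃ x ∈ S \ Z, ¬ P x) →
      ConnOn G.Adj (G.vertexSet \ (Z ∪ {x ∈ S | P x})) := by
    rintro P hP ⟨a, ha, hPa⟩ ⟨b, hb, hPb⟩
    obtain ⟨t, ht⟩ := hc.1
    have hsub : G.vertexSet \ S ⊆ G.vertexSet \ (Z ∪ {x ∈ S | P x}) :=
      fun x hx ↦ ⟨hx.1, fun h ↦ hx.2 (h.elim (fun h ↦ hZS h) fun h ↦ h.1)⟩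
    -- A closed set missing the complement of `S` is separated from it by `Z`.
    have main : ∀ Q : α → Prop, (∀ x ∈ G.vertexSet \ (Z ∪ {x ∈ S | P x}),
        ∀ y ∈ G.vertexSet \ (Z ∪ {x ∈ S | P x}), G.Adj x y → Q x → Q y) →
        (∃ x ∈ G.vertexSet \ (Z ∪ {x ∈ S | P x}), Q x) →
        (∃ x ∈ G.vertexSet \ S, Q x) := by
      rintro Q hQ ⟨x, hx, hQx⟩
      by_contra! hno
      have hall := (hG2.connOn_diff_of_subsingleton hZ (hZS.trans hS.1)).2
        (fun z ↦ z ∈ S ∧ ¬ P z ∧ Q z) ?_ ⟨x, ?_, ?_⟩ t ⟨ht.1, fun h ↦ ht.2 (hZS h)⟩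
      · exact ht.2 hall.1
      · rintro z hz w hw hzw ⟨hzS, hPz, hQz⟩
        have hzm : z ∈ G.vertexSet \ (Z ∪ {x ∈ S | P x}) :=
          ⟨hz.1, fun h ↦ h.elim hz.2 fun h ↦ hPz h.2⟩
        by_cases hwS : w ∈ S
        · have hPw : ¬ P w := fun h ↦ hPz ((hP z ⟨hzS, hz.2⟩ w ⟨hwS, hw.2⟩ hzw).2 h)
          exact ⟨hwS, hPw, hQ z hzm w ⟨hw.1, fun h ↦ h.elim hw.2 fun h ↦ hPw h.2⟩ hzw hQz⟩
        · exact (hno w ⟨hw.1, hwS⟩ (hQ z hzm w (hsub ⟨hw.1, hwS⟩) hzw hQz)).elim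
      · exact ⟨hx.1, fun h ↦ hx.2 (.inl h)⟩
      · have hxS : x ∈ S := by
          by_contra h
          exact hno x ⟨hx.1, h⟩ hQx
        exact ⟨hxS, fun h ↦ hx.2 (.inr ⟨hxS, h⟩), hQx⟩
    refine ⟨⟨t, hsub ht⟩, fun Q hQ hx y hy ↦ ?_⟩
    have h1 := hc.2 Q (fun x hx y hy ↦ hQ x (hsub hx) y (hsub hy)) (main Q hQ hx)
    by_contra hQy
    obtain ⟨z, hz, hQz⟩ := main (fun x ↦ ¬ Q x)
      (fun x hx y hy hxy hQx hQy ↦ hQx (hQ y hy x hx hxy.symm hQy)) ⟨y, hy, hQy⟩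
    exact hQz (h1 z hz)
  obtain ⟨P, hP, ⟨a, ha, hPa⟩, b, hb, hPb⟩ : ∃ P : α → Prop,
      (∀ x ∈ S \ Z, ∀ y ∈ S \ Z, G.Adj x y → P x → P y) ∧
      (∃ x ∈ S \ Z, P x) ∧ ∃ y ∈ S \ Z, ¬ P y := by
    by_contra! hcon
    exact hn ⟨hSZ, fun P hP hx y hy ↦ hcon P hP hx y hy⟩
  have hP' : ∀ x ∈ S \ Z, ∀ y ∈ S \ Z, G.Adj x y → (P x ↔ P y) :=
    fun x hx y hy hxy ↦ ⟨hP x hx y hy hxy, hP y hy x hx hxy.symm⟩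
  have hcX := key P hP' ⟨a, ha, hPa⟩ ⟨b, hb, hPb⟩
  have hcY := key (fun x ↦ ¬ P x) (fun x hx y hy hxy ↦ not_congr (hP' x hx y hy hxy))
    ⟨b, hb, hPb⟩ ⟨a, ha, not_not.2 hPa⟩
  set X := Z ∪ {x ∈ S | P x} with hX
  set Y := Z ∪ {x ∈ S | ¬ P x} with hY
  have hXS : X ⊆ S := Set.union_subset hZS fun x hx ↦ hx.1
  have hYS : Y ⊆ S := Set.union_subset hZS fun x hx ↦ hx.1
  have hXlt : X.ncard < S.ncard := Set.ncard_lt_ncard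
    ⟨hXS, fun h ↦ (h hb.1).elim hb.2 fun h ↦ hPb h.2⟩ hSf
  have hYlt : Y.ncard < S.ncard := Set.ncard_lt_ncard
    ⟨hYS, fun h ↦ (h ha.1).elim ha.2 fun h ↦ h.2 hPa⟩ hSf
  have hXY : X ∪ Y = S := by
    refine subset_antisymm (Set.union_subset hXS hYS) fun x hx ↦ ?_
    by_cases hPx : P x
    · exact .inl (.inr ⟨hx, hPx⟩)
    · exact .inr (.inr ⟨hx, hPx⟩)
  have hXiY : X ∩ Y = Z := by
    ext x
    simp only [hX, hY, Set.mem_inter_iff, Set.mem_union, Set.mem_ofPred_eq]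
    tauto
  have hi := ncard_edgesWithin_add (X := X) (Y := Y) hE (by
    intro x hx hxY y hy hyX hxy
    have hxZ : x ∉ Z := fun h ↦ hxY (.inl h)
    have hyZ : y ∉ Z := fun h ↦ hyX (.inl h)
    exact (hy.resolve_left hyZ).2
      (hP x ⟨hXS hx, hxZ⟩ y ⟨hYS hy, hyZ⟩ hxy (hx.resolve_left hxZ).2))
  have hnc := Set.ncard_union_add_ncard_inter X Y (hSf.subset hXS) (hSf.subset hYS)
  rw [hXY, hXiY] at hi hnc
  rw [edgesWithin_eq_empty_of_subsingleton hl hZ, Set.ncard_empty] at hi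
  -- One-element sets contain no edge, so a part violating the bound strictly is not one of them.
  have hsing : ∀ W ⊆ S, W.ncard ≤ 1 → (G.edgesWithin W).ncard = 0 := fun W hW h ↦ by
    rw [edgesWithin_eq_empty_of_subsingleton hl
      ((Set.ncard_le_one (hSf.subset hW)).1 h), Set.ncard_empty]
  have hX1 : Z.ncard + 1 ≤ X.ncard := Set.ncard_lt_ncard
    ⟨Set.subset_union_left, fun h ↦ ha.2 (h (.inr ⟨ha.1, hPa⟩))⟩ (hSf.subset hXS)
  have hY1 : Z.ncard + 1 ≤ Y.ncard := Set.ncard_lt_ncard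
    ⟨Set.subset_union_left, fun h ↦ hb.2 (h (.inr ⟨hb.1, hPb⟩))⟩ (hSf.subset hYS)
  have hsX := hsing X hXS
  have hsY := hsing Y hYS
  by_cases hdX : 2 ≤ X.ncard ∧ 2 * X.ncard ≤ (G.edgesWithin X).ncard + 2
  · exact ⟨X, hXS.trans_ssubset hS, hXlt, hdX.1, hdX.2, hcX⟩
  · have hdY : 2 ≤ Y.ncard ∧ 2 * Y.ncard ≤ (G.edgesWithin Y).ncard + 2 := by omega
    exact ⟨Y, hYS.trans_ssubset hS, hYlt, hdY.1, hdY.2, hcY⟩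

/-- The equalities at good flats force the sparsity bound at all proper vertex subsets: a violating
set that is first enlarged until its complement is connected, and then shrunk as long as its
complement stays connected, ends up as a good flat. -/
lemma UnitSpade.ncard_edgesWithin_le (h : G.UnitSpade) (hV : G.vertexSet.Finite)
    (hE : G.edgeSet.Finite) (hG : G.IsTwoConnected) {S : Set α} (hS : S ⊂ G.vertexSet)
    (h2 : 2 ≤ S.ncard) : (G.edgesWithin S).ncard + 3 ≤ 2 * S.ncard := by
  by_contra! hd
  have up : ∀ (n : ℕ) (S : Set α), G.vertexSet.ncard - S.ncard = n → S ⊂ G.vertexSet →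
      2 ≤ S.ncard → 2 * S.ncard ≤ (G.edgesWithin S).ncard + 2 →
      ∃ T ⊂ G.vertexSet, 2 ≤ T.ncard ∧ 2 * T.ncard ≤ (G.edgesWithin T).ncard + 2 ∧
        ConnOn G.Adj (G.vertexSet \ T) := by
    intro n
    induction n using Nat.strong_induction_on with
    | _ n ih =>
      intro S hn hS h2 hd
      by_cases hc : ConnOn G.Adj (G.vertexSet \ S)
      · exact ⟨S, hS, h2, hd, hc⟩
      · obtain ⟨T, hT, hlt, hdT⟩ := exists_larger_dense hV hE h.1 hS hd hc
        have := Set.ncard_lt_ncard hT hV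
        exact ih _ (by omega) T rfl hT (by omega) hdT
  have down : ∀ (n : ℕ) (S : Set α), S.ncard = n → S ⊂ G.vertexSet →
      2 ≤ S.ncard → 2 * S.ncard ≤ (G.edgesWithin S).ncard + 2 →
      ¬ ConnOn G.Adj (G.vertexSet \ S) := by
    intro n
    induction n using Nat.strong_induction_on with
    | _ n ih =>
      intro S hn hS h2 hd hc
      by_cases hZ : ∃ Z ⊆ S, Z.Subsingleton ∧ ¬ ConnOn G.Adj (S \ Z)
      · obtain ⟨Z, hZS, hZ, hnc⟩ := hZ
        obtain ⟨T, hT, hlt, h2T, hdT, hcT⟩ := exists_smaller_dense hV hE hG hS h2 hd hc hZ hZS hnc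
        exact ih _ (by omega) T rfl hT h2T hdT hcT
      · push Not at hZ
        have := h.2 S hS ⟨(Set.one_lt_ncard (hV.subset hS.1)).1 h2,
          by simpa using hZ ∅ (Set.empty_subset _) Set.subsingleton_empty,
          fun x hx ↦ hZ {x} (by simpa using hx) Set.subsingleton_singleton⟩ hc
        omega
  obtain ⟨T, hT, h2T, hdT, hcT⟩ := up _ S rfl hS h2 (by omega)
  exact down _ T rfl hT h2T hdT hcT

end Bound

/-! ### Connectivity across a 2-separation -/

section TwoSeparation

variable {α : Type*} {R : α → α → Prop} {A B S T : Set α} {u v : α}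

/-- The relation `R` with the pair `u, v` added. -/
def withPair (R : α → α → Prop) (u v : α) (x y : α) : Prop :=
  R x y ∨ (x = u ∧ y = v) ∨ (x = v ∧ y = u)

/-- The sets `A` and `B` meet exactly in the two elements `u` and `v`, and each pair in the
symmetric relation `R` lies in `A` or in `B`. -/
structure IsTwoSep (R : α → α → Prop) (A B : Set α) (u v : α) : Prop where
  symm : ∀ x y, R x y → R y x
  ne : u ≠ v
  inter : ∀ x, x ∈ A ∧ x ∈ B ↔ x = u ∨ x = v
  cross : ∀ x y, R x y → (x ∈ A ∧ y ∈ A) ∨ (x ∈ B ∧ y ∈ B)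

lemma IsTwoSep.swap (h : IsTwoSep R A B u v) : IsTwoSep R B A u v :=
  ⟨h.symm, h.ne, fun x ↦ by rw [and_comm, h.inter], fun x y hxy ↦ (h.cross x y hxy).symm⟩

lemma IsTwoSep.restrict (h : IsTwoSep R A B u v) (hS : S ⊆ A) (hu : u ∈ S) (hv : v ∈ S) :
    IsTwoSep (fun x y ↦ R x y ∧ x ∈ S ∪ B ∧ y ∈ S ∪ B) S B u v := by
  refine ⟨fun x y h' ↦ ⟨h.symm _ _ h'.1, h'.2.2, h'.2.1⟩, h.ne, fun x ↦ ?_, fun x y h' ↦ ?_⟩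
  · have := h.inter x
    constructor
    · exact fun hx ↦ this.1 ⟨hS hx.1, hx.2⟩
    · rintro (rfl | rfl)
      exacts [⟨hu, (this.2 (.inl rfl)).2⟩, ⟨hv, (this.2 (.inr rfl)).2⟩]
  · obtain ⟨hxy, hx, hy⟩ := h'
    have h1 := h.cross x y hxy
    have h2 := h.inter x
    have h3 := h.inter y
    simp only [Set.mem_union] at hx hy
    grind

/-- A set that is connected after adding all of `B` stays connected when `B` is replaced by the
pair `u, v`. -/
lemma IsTwoSep.connOn_withPair (h : IsTwoSep R A B u v) (hT : T ⊆ A) (hne : u ∈ T ∨ v ∈ T)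
    (hc : ConnOn R (T ∪ (B \ A))) : ConnOn (withPair R u v) T := by
  refine ⟨hne.elim (fun h ↦ ⟨u, h⟩) fun h ↦ ⟨v, h⟩, fun P hP ⟨x, hx, hPx⟩ y hy ↦ ?_⟩
  -- The side `B` takes the value of `P` at the ends `u, v` that lie in `T`.
  have key := hc.2 (fun z ↦ (z ∈ T ∧ P z) ∨ (z ∈ B \ A ∧ ((u ∈ T ∧ P u) ∨ (v ∈ T ∧ P v)))) ?_
    ⟨x, .inl hx, .inl ⟨hx, hPx⟩⟩ y (.inl hy)
  · obtain h' | h' := key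
    · exact h'.2
    · exact (h'.1.2 (hT hy)).elim
  · intro a ha b hb hab hPa
    have h1 := h.cross a b hab
    have h2 := h.inter a
    have h3 := h.inter b
    have h4 : u ∈ T → v ∈ T → (P u ↔ P v) := fun hu hv ↦
      ⟨hP u hu v hv (.inr (.inl ⟨rfl, rfl⟩)), hP v hv u hu (.inr (.inr ⟨rfl, rfl⟩))⟩
    have h5 := fun ha hb ↦ hP a ha b hb (.inl hab)
    have h6 := @hT a
    have h7 := @hT b
    simp only [Set.mem_union, Set.mem_sdiff] at ha hb hPa ⊢
    grind

/-- Conversely, the pair `u, v` may be replaced by the side `B` if `B` is connected and stays so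
when `u` or `v` is removed. -/
lemma IsTwoSep.connOn_of_withPair (h : IsTwoSep R A B u v) (hT : T ⊆ A) (hne : u ∈ T ∨ v ∈ T)
    (hB : ConnOn R B) (hBu : ConnOn R (B \ {u})) (hBv : ConnOn R (B \ {v}))
    (hc : ConnOn (withPair R u v) T) : ConnOn R (T ∪ (B \ A)) := by
  refine ⟨hc.1.inl, fun P hP hx ↦ ?_⟩
  have hu := (h.inter u).2 (.inl rfl)
  have hv := (h.inter v).2 (.inr rfl)
  -- It suffices that `P` is constant on the part `C` of `B` that belongs to the set.
  have main : ∀ C : Set α, (∀ x, x ∈ C ↔ x ∈ B ∧ x ∈ T ∪ (B \ A)) → ConnOn R C →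
      ∀ x ∈ T ∪ (B \ A), P x := by
    intro C hC hCc
    have hCP := hCc.2 P fun x hx y hy ↦ hP x ((hC x).1 hx).2 y ((hC y).1 hy).2
    have hTP := hc.2 P fun x hx y hy hxy hPx ↦ by
      obtain hxy | ⟨rfl, rfl⟩ | ⟨rfl, rfl⟩ := hxy
      · exact hP x (.inl hx) y (.inl hy) hxy hPx
      · exact hCP ⟨x, (hC x).2 ⟨hu.2, .inl hx⟩, hPx⟩ _ ((hC y).2 ⟨hv.2, .inl hy⟩)
      · exact hCP ⟨x, (hC x).2 ⟨hv.2, .inl hx⟩, hPx⟩ _ ((hC y).2 ⟨hu.2, .inl hy⟩)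
    obtain ⟨w, hwT, hwB⟩ : ∃ w ∈ T, w ∈ B := hne.elim (⟨u, ·, hu.2⟩) (⟨v, ·, hv.2⟩)
    have hwC : w ∈ C := (hC w).2 ⟨hwB, .inl hwT⟩
    have hPw : P w := by
      obtain ⟨x, hx | hx, hPx⟩ := hx
      · exact hTP ⟨x, hx, hPx⟩ w hwT
      · exact hCP ⟨x, (hC x).2 ⟨hx.1, .inr hx⟩, hPx⟩ w hwC
    rintro x (hx | hx)
    · exact hTP ⟨w, hwT, hPw⟩ x hx
    · exact hCP ⟨w, hwC, hPw⟩ x ((hC x).2 ⟨hx.1, .inr hx⟩)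
  have hdisj : ∀ x ∈ B, x ∈ A → x = u ∨ x = v := fun x hB hA ↦ (h.inter x).1 ⟨hA, hB⟩
  have huv := h.ne
  by_cases huT : u ∈ T
  · by_cases hvT : v ∈ T
    · refine main B (fun x ↦ ?_) hB
      simp only [Set.mem_union, Set.mem_sdiff]
      grind
    · refine main (B \ {v}) (fun x ↦ ?_) hBv
      have := @hT x
      simp only [Set.mem_union, Set.mem_sdiff, Set.mem_singleton_iff]
      grind
  · have hvT := hne.resolve_left huT
    refine main (B \ {u}) (fun x ↦ ?_) hBu
    have := @hT x
    simp only [Set.mem_union, Set.mem_sdiff, Set.mem_singleton_iff]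
    grind

/-- Removing the pair `u, v` from a 2-connected relation on at least three elements leaves a
connected relation. -/
lemma TwoConnOn.connOn_of_withPair
    (h : TwoConnOn (withPair R u v) S) (hu : u ∈ S) (hv : v ∈ S) (huv : u ≠ v)
    (hw : ∃ w ∈ S, w ≠ u ∧ w ≠ v) :
    ConnOn R S ∧ ConnOn R (S \ {u}) ∧ ConnOn R (S \ {v}) := by
  have h1 : ConnOn R (S \ {u}) := (h.2.2 u hu).mono fun x hx y hy hxy ↦ by
    obtain h | ⟨rfl, rfl⟩ | ⟨rfl, rfl⟩ := hxy
    exacts [h, (hx.2 rfl).elim, (hy.2 rfl).elim]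
  have h2 : ConnOn R (S \ {v}) := (h.2.2 v hv).mono fun x hx y hy hxy ↦ by
    obtain h | ⟨rfl, rfl⟩ | ⟨rfl, rfl⟩ := hxy
    exacts [h, (hy.2 rfl).elim, (hx.2 rfl).elim]
  obtain ⟨w, hwS, hwu, hwv⟩ := hw
  refine ⟨⟨⟨u, hu⟩, fun P hP ⟨x, hx, hPx⟩ ↦ ?_⟩, h1, h2⟩
  have h1' := h1.2 P fun x hx y hy ↦ hP x hx.1 y hy.1
  have h2' := h2.2 P fun x hx y hy ↦ hP x hx.1 y hy.1
  have hPw : P w := by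
    by_cases hxu : x = u
    · exact h2' ⟨x, ⟨hx, by rintro rfl; exact huv hxu.symm⟩, hPx⟩ w ⟨hwS, hwv⟩
    · exact h1' ⟨x, ⟨hx, hxu⟩, hPx⟩ w ⟨hwS, hwu⟩
  intro y hy
  by_cases hyu : y = u
  · exact h2' ⟨w, ⟨hwS, hwv⟩, hPw⟩ y ⟨hy, by rintro rfl; exact huv hyu.symm⟩
  · exact h1' ⟨w, ⟨hwS, hwu⟩, hPw⟩ y ⟨hy, hyu⟩

lemma twoConnOn_withPair_iff_of_not (hne : ¬ (u ∈ S ∧ v ∈ S)) :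
    TwoConnOn (withPair R u v) S ↔ TwoConnOn R S := by
  refine ⟨fun h ↦ h.mono fun x hx y hy hxy ↦ ?_, fun h ↦ h.mono fun x _ y _ hxy ↦ .inl hxy⟩
  obtain h | ⟨rfl, rfl⟩ | ⟨rfl, rfl⟩ := hxy
  exacts [h, (hne ⟨hx, hy⟩).elim, (hne ⟨hy, hx⟩).elim]

/-- If `S ∪ B` is 2-connected, then so is `S` with the pair `u, v` in the place of `B`. -/
lemma IsTwoSep.twoConnOn_withPair (h : IsTwoSep R A B u v) (hS : S ⊆ A) (hu : u ∈ S)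
    (hv : v ∈ S) (hc : TwoConnOn R (S ∪ B)) : TwoConnOn (withPair R u v) S := by
  have huB := ((h.inter u).2 (.inl rfl)).2
  have hvB := ((h.inter v).2 (.inr rfl)).2
  have huv := h.ne
  have hSB : S ∪ B = S ∪ (B \ A) := by
    ext x
    have := h.inter x
    simp only [Set.mem_union, Set.mem_sdiff]
    grind
  refine ⟨⟨u, hu, v, hv, h.ne⟩, h.connOn_withPair hS (.inl hu) (hSB ▸ hc.2.1), fun x hx ↦ ?_⟩
  refine h.connOn_withPair (Set.sdiff_subset.trans hS) ?_ ?_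
  · by_cases hxu : x = u
    · exact .inr ⟨hv, fun h ↦ huv (hxu.symm.trans h.symm)⟩
    · exact .inl ⟨hu, fun h ↦ hxu h.symm⟩
  · have := hc.2.2 x (.inl hx)
    have hxA := hS hx
    convert this using 1
    rw [hSB]
    ext y
    simp only [Set.mem_union, Set.mem_sdiff, Set.mem_singleton_iff]
    grind

/-- Gluing 2-connected relations along the pair `u, v` and removing this pair leaves a 2-connected
relation, if both sides have a further element. -/
lemma IsTwoSep.twoConnOn_union (h : IsTwoSep R A B u v) (hS : S ⊆ A) (hu : u ∈ S) (hv : v ∈ S)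
    (hSw : ∃ w ∈ S, w ≠ u ∧ w ≠ v) (hBw : ∃ w ∈ B, w ≠ u ∧ w ≠ v)
    (hSc : TwoConnOn (withPair R u v) S) (hBc : TwoConnOn (withPair R u v) B) :
    TwoConnOn R (S ∪ B) := by
  have huB := ((h.inter u).2 (.inl rfl)).2
  have hvB := ((h.inter v).2 (.inr rfl)).2
  have huv := h.ne
  have hSB : ∀ x, x ∈ S ∧ x ∈ B ↔ x = u ∨ x = v := fun x ↦ (h.restrict hS hu hv).inter x
  have hAB := h.inter
  obtain ⟨hS0, hSu, hSv⟩ := hSc.connOn_of_withPair hu hv huv hSw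
  obtain ⟨hB0, hBu, hBv⟩ := hBc.connOn_of_withPair huB hvB huv hBw
  refine ⟨⟨u, .inl hu, v, .inl hv, huv⟩, ?_, fun x hx ↦ ?_⟩
  · convert h.connOn_of_withPair hS (.inl hu) hB0 hBu hBv hSc.2.1 using 1
    ext x
    have := hAB x
    simp only [Set.mem_union, Set.mem_sdiff]
    grind
  · by_cases hxS : x ∈ S
    · convert h.connOn_of_withPair (T := S \ {x}) (Set.sdiff_subset.trans hS) (by
        simp only [Set.mem_sdiff, Set.mem_singleton_iff]; grind) hB0 hBu hBv (hSc.2.2 x hxS) using 1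
      ext y
      have := hAB y
      have := hS hxS
      have := @hS y
      have := hSB x
      simp only [Set.mem_union, Set.mem_sdiff, Set.mem_singleton_iff]
      grind
    · -- The roles of the two sides are exchanged, with `S` in the place of `A`.
      have hxB := hx.resolve_left hxS
      have hr := (h.restrict hS hu hv).swap
      have hmono : ∀ C ⊆ S, ConnOn R C →
          ConnOn (fun x y ↦ R x y ∧ x ∈ S ∪ B ∧ y ∈ S ∪ B) C :=
        fun C hC h ↦ h.mono fun a ha b hb hab ↦ ⟨hab, .inl (hC ha), .inl (hC hb)⟩
      have := hr.connOn_of_withPair (T := B \ {x}) Set.sdiff_subset (by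
        have := hSB x
        simp only [Set.mem_sdiff, Set.mem_singleton_iff]; grind)
        (hmono _ subset_rfl hS0) (hmono _ Set.sdiff_subset hSu) (hmono _ Set.sdiff_subset hSv)
        ((hBc.2.2 x hxB).mono fun a ha b hb hab ↦
          hab.imp (fun h ↦ ⟨h, .inr ha.1, .inr hb.1⟩) id)
      convert this.mono (R' := R) fun a _ b _ hab ↦ hab.1 using 1
      ext y
      simp only [Set.mem_union, Set.mem_sdiff, Set.mem_singleton_iff]
      grind

/-- A 2-connected set that does not contain both `u` and `v` lies on one side. -/
lemma IsTwoSep.subset_or_subset (h : IsTwoSep R A B u v) (hS : S ⊆ A ∪ B)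
    (hc : TwoConnOn R S) (huv : ¬ (u ∈ S ∧ v ∈ S)) : S ⊆ A ∨ S ⊆ B := by
  by_contra! hcon
  obtain ⟨⟨x, hxS, hxA⟩, y, hyS, hyB⟩ := hcon.imp Set.not_subset.1 Set.not_subset.1
  -- Removing the element of `{u, v}` that lies in `S`, if any, leaves `S` connected.
  have hZ : (S ∩ {u, v}).Subsingleton := by
    rintro a ⟨ha, rfl | rfl⟩ b ⟨hb, rfl | rfl⟩
    exacts [rfl, (huv ⟨ha, hb⟩).elim, (huv ⟨hb, ha⟩).elim, rfl]
  have hcZ := hc.connOn_diff_of_subsingleton hZ Set.inter_subset_left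
  have hyA := (hS hyS).resolve_right hyB
  have := hcZ.2 (· ∈ A) (fun a ha b hb hab haA ↦ by
    obtain h' | h' := h.cross a b hab
    · exact h'.2
    · exact (ha.2 ⟨ha.1, (h.inter a).1 ⟨haA, h'.1⟩⟩).elim)
    ⟨y, ⟨hyS, fun hy ↦ hyB ((h.inter y).2 hy.2).2⟩, hyA⟩ x
    ⟨hxS, fun hx ↦ hxA ((h.inter x).2 hx.2).1⟩
  exact hxA this

/-- A connected set avoiding `u` and `v` lies on one side. -/
lemma IsTwoSep.subset_or_subset_of_connOn (h : IsTwoSep R A B u v) (hS : S ⊆ A ∪ B)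
    (hc : ConnOn R S) (hu : u ∉ S) (hv : v ∉ S) : S ⊆ A ∨ S ⊆ B := by
  by_contra! hcon
  obtain ⟨⟨x, hxS, hxA⟩, y, hyS, hyB⟩ := hcon.imp Set.not_subset.1 Set.not_subset.1
  have hyA := (hS hyS).resolve_right hyB
  refine hxA (hc.2 (· ∈ A) (fun a ha b hb hab haA ↦ ?_) ⟨y, hyS, hyA⟩ x hxS)
  obtain h' | h' := h.cross a b hab
  · exact h'.2
  · obtain rfl | rfl := (h.inter a).1 ⟨haA, h'.1⟩
    exacts [(hu ha).elim, (hv ha).elim]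

end TwoSeparation

/-! ### Gluing along an edge -/

section Gluing

variable {α₁ α₂ α : Type u} {β₁ β₂ β : Type v} {G₁ : Graph α₁ β₁} {e₁ : β₁} {G₂ : Graph α₂ β₂}
  {e₂ : β₂} {G : Graph α β}

namespace EdgeGluing

/-- The gluing with the roles of the two parts exchanged. -/
def swap (D : EdgeGluing G₁ e₁ G₂ e₂ G) : EdgeGluing G₂ e₂ G₁ e₁ G where
  u₁ := D.u₂
  v₁ := D.v₂
  u₂ := D.u₁
  v₂ := D.v₁
  isLink₁ := D.isLink₂
  isLink₂ := D.isLink₁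
  φ₁ := D.φ₂
  φ₂ := D.φ₁
  injOn_φ₁ := D.injOn_φ₂
  injOn_φ₂ := D.injOn_φ₁
  glue_u := D.glue_u.symm
  glue_v := D.glue_v.symm
  vertexSet_inter := by rw [Set.inter_comm, D.vertexSet_inter, D.glue_u, D.glue_v]
  vertexSet_eq := by rw [D.vertexSet_eq, Set.union_comm]
  ψ₁ := D.ψ₂
  ψ₂ := D.ψ₁
  injOn_ψ₁ := D.injOn_ψ₂
  injOn_ψ₂ := D.injOn_ψ₁
  edgeSet_disjoint := D.edgeSet_disjoint.symm
  edgeSet_eq := by rw [D.edgeSet_eq, Set.union_comm]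
  map_isLink₁ := D.map_isLink₂
  map_isLink₂ := D.map_isLink₁

variable (D : EdgeGluing G₁ e₁ G₂ e₂ G)

/-- The vertices of the first part, inside the glued graph. -/
abbrev side₁ : Set α := D.φ₁ '' G₁.vertexSet

/-- The vertices of the second part, inside the glued graph. -/
abbrev side₂ : Set α := D.φ₂ '' G₂.vertexSet

/-- The vertices of the first part that lie in `S`. -/
abbrev trace₁ (S : Set α) : Set α₁ := G₁.vertexSet ∩ D.φ₁ ⁻¹' S

/-- The vertices of the second part that lie in `S`. -/
abbrev trace₂ (S : Set α) : Set α₂ := G₂.vertexSet ∩ D.φ₂ ⁻¹' S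

/-- The relation on the vertices of the glued graph that describes adjacency in the parts: the
deleted edge is put back. -/
abbrev adj : α → α → Prop := withPair G.Adj (D.φ₁ D.u₁) (D.φ₁ D.v₁)

lemma adj_swap : D.swap.adj = D.adj := by
  change withPair G.Adj (D.φ₂ D.u₂) (D.φ₂ D.v₂) = _
  rw [← D.glue_u, ← D.glue_v]

lemma finite_vertexSet (D : EdgeGluing G₁ e₁ G₂ e₂ G)
    (h₁ : G₁.vertexSet.Finite) (h₂ : G₂.vertexSet.Finite) :
    G.vertexSet.Finite := by
  rw [D.vertexSet_eq]
  exact (h₁.image _).union (h₂.image _)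

lemma finite_edgeSet (D : EdgeGluing G₁ e₁ G₂ e₂ G)
    (h₁ : G₁.edgeSet.Finite) (h₂ : G₂.edgeSet.Finite) :
    G.edgeSet.Finite := by
  rw [D.edgeSet_eq]
  exact ((h₁.subset Set.sdiff_subset).image _).union ((h₂.subset Set.sdiff_subset).image _)

lemma u_ne_v (h₁ : G₁.Loopless) : D.φ₁ D.u₁ ≠ D.φ₁ D.v₁ := by
  intro h
  have := D.injOn_φ₁ D.isLink₁.left_mem D.isLink₁.right_mem h
  exact h₁.not_isLoopAt e₁ D.u₁ (by simpa [← this] using D.isLink₁)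

/-- Each edge of the glued graph comes from one of the two parts. -/
lemma isLink_cases {e : β} {x y : α} (h : G.IsLink e x y) :
    (∃ f ∈ G₁.edgeSet \ {e₁}, ∃ a b, G₁.IsLink f a b ∧ D.ψ₁ f = e ∧ D.φ₁ a = x ∧ D.φ₁ b = y) ∨
    ∃ f ∈ G₂.edgeSet \ {e₂}, ∃ a b, G₂.IsLink f a b ∧ D.ψ₂ f = e ∧ D.φ₂ a = x ∧ D.φ₂ b = y := by
  have he := h.edge_mem
  rw [D.edgeSet_eq] at he
  obtain ⟨f, hf, rfl⟩ | ⟨f, hf, rfl⟩ := he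
  · obtain ⟨a, b, hab⟩ := exists_isLink_of_mem_edgeSet hf.1
    obtain ⟨rfl, rfl⟩ | ⟨rfl, rfl⟩ := (D.map_isLink₁ f hf a b hab).eq_and_eq_or_eq_and_eq h
    · exact .inl ⟨f, hf, a, b, hab, rfl, rfl, rfl⟩
    · exact .inl ⟨f, hf, b, a, hab.symm, rfl, rfl, rfl⟩
  · obtain ⟨a, b, hab⟩ := exists_isLink_of_mem_edgeSet hf.1
    obtain ⟨rfl, rfl⟩ | ⟨rfl, rfl⟩ := (D.map_isLink₂ f hf a b hab).eq_and_eq_or_eq_and_eq h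
    · exact .inr ⟨f, hf, a, b, hab, rfl, rfl, rfl⟩
    · exact .inr ⟨f, hf, b, a, hab.symm, rfl, rfl, rfl⟩

lemma isTwoSep (h₁ : G₁.Loopless) :
    IsTwoSep G.Adj D.side₁ D.side₂ (D.φ₁ D.u₁) (D.φ₁ D.v₁) := by
  refine ⟨fun x y h ↦ h.symm, D.u_ne_v h₁, fun x ↦ ?_, ?_⟩
  · rw [← Set.mem_inter_iff, D.vertexSet_inter]
    rfl
  · rintro x y ⟨e, he⟩
    obtain ⟨f, -, a, b, hab, -, rfl, rfl⟩ | ⟨f, -, a, b, hab, -, rfl, rfl⟩ := D.isLink_cases he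
    · exact .inl ⟨⟨a, hab.left_mem, rfl⟩, b, hab.right_mem, rfl⟩
    · exact .inr ⟨⟨a, hab.left_mem, rfl⟩, b, hab.right_mem, rfl⟩

lemma adj_iff₁ (h₂ : G₂.Loopless) {x y : α₁} (hx : x ∈ G₁.vertexSet)
    (hy : y ∈ G₁.vertexSet) : G₁.Adj x y ↔ D.adj (D.φ₁ x) (D.φ₁ y) := by
  have hu := D.isLink₁.left_mem
  have hv := D.isLink₁.right_mem
  constructor
  · rintro ⟨e, he⟩
    by_cases hee : e = e₁
    · subst hee
      obtain ⟨rfl, rfl⟩ | ⟨rfl, rfl⟩ := he.eq_and_eq_or_eq_and_eq D.isLink₁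
      · exact .inr (.inl ⟨rfl, rfl⟩)
      · exact .inr (.inr ⟨rfl, rfl⟩)
    · exact .inl ⟨_, D.map_isLink₁ e ⟨he.edge_mem, hee⟩ x y he⟩
  · rintro (⟨e, he⟩ | ⟨hxu, hyv⟩ | ⟨hxv, hyu⟩)
    · obtain ⟨f, -, a, b, hab, -, ha, hb⟩ | ⟨f, -, a, b, hab, -, ha, hb⟩ := D.isLink_cases he
      · obtain rfl := D.injOn_φ₁ hab.left_mem hx ha
        obtain rfl := D.injOn_φ₁ hab.right_mem hy hb
        exact ⟨f, hab⟩
      · -- An edge of the second part between vertices of the first part joins the glued vertices.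
        have hmem : ∀ z ∈ G₁.vertexSet, D.φ₁ z ∈ D.side₂ → z = D.u₁ ∨ z = D.v₁ := by
          intro z hz hz2
          have : D.φ₁ z ∈ D.side₁ ∩ D.side₂ := ⟨⟨z, hz, rfl⟩, hz2⟩
          rw [D.vertexSet_inter] at this
          exact this.imp (D.injOn_φ₁ hz hu) (D.injOn_φ₁ hz hv)
        have hxy : x ≠ y := by
          rintro rfl
          obtain rfl := D.injOn_φ₂ hab.left_mem hab.right_mem (ha.trans hb.symm)
          exact h₂.not_isLoopAt f _ hab
        have hx' := hmem x hx ⟨a, hab.left_mem, ha⟩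
        have hy' := hmem y hy ⟨b, hab.right_mem, hb⟩
        obtain rfl | rfl := hx' <;> obtain rfl | rfl := hy'
        exacts [(hxy rfl).elim, ⟨e₁, D.isLink₁⟩, ⟨e₁, D.isLink₁.symm⟩, (hxy rfl).elim]
    · rw [D.injOn_φ₁ hx hu hxu, D.injOn_φ₁ hy hv hyv]
      exact ⟨e₁, D.isLink₁⟩
    · rw [D.injOn_φ₁ hx hv hxv, D.injOn_φ₁ hy hu hyu]
      exact ⟨e₁, D.isLink₁.symm⟩

lemma connOn_iff₁ (h₂ : G₂.Loopless) {S : Set α₁} (hS : S ⊆ G₁.vertexSet) :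
    ConnOn D.adj (D.φ₁ '' S) ↔ ConnOn G₁.Adj S :=
  connOn_image_iff (D.injOn_φ₁.mono hS) fun _ hx _ hy ↦ D.adj_iff₁ h₂ (hS hx) (hS hy)

lemma twoConnOn_iff₁ (h₂ : G₂.Loopless) {S : Set α₁} (hS : S ⊆ G₁.vertexSet) :
    TwoConnOn D.adj (D.φ₁ '' S) ↔ TwoConnOn G₁.Adj S :=
  twoConnOn_image_iff (D.injOn_φ₁.mono hS) fun _ hx _ hy ↦ D.adj_iff₁ h₂ (hS hx) (hS hy)

lemma twoConnOn_iff₂ (h₁ : G₁.Loopless) {S : Set α₂} (hS : S ⊆ G₂.vertexSet) :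
    TwoConnOn D.adj (D.φ₂ '' S) ↔ TwoConnOn G₂.Adj S :=
  D.adj_swap ▸ D.swap.twoConnOn_iff₁ h₁ hS

lemma image_trace₁ {S : Set α} (hS : S ⊆ D.side₁) : D.φ₁ '' D.trace₁ S = S := by
  rw [Set.image_inter_preimage, Set.inter_eq_right.2 hS]

lemma ncard_vertexSet_add (D : EdgeGluing G₁ e₁ G₂ e₂ G)
    (h₁ : G₁.Loopless) (hV₁ : G₁.vertexSet.Finite)
    (hV₂ : G₂.vertexSet.Finite) :
    G.vertexSet.ncard + 2 = G₁.vertexSet.ncard + G₂.vertexSet.ncard := by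
  have := Set.ncard_union_add_ncard_inter D.side₁ D.side₂ (hV₁.image _) (hV₂.image _)
  rwa [D.vertexSet_inter, ← D.vertexSet_eq, Set.ncard_pair (D.u_ne_v h₁),
    D.injOn_φ₁.ncard_image, D.injOn_φ₂.ncard_image] at this

/-- The edges inside `S` come from the edges inside the traces of `S` on the two parts. -/
lemma ncard_edgesWithin (hE₁ : G₁.edgeSet.Finite) (hE₂ : G₂.edgeSet.Finite) (S : Set α) :
    (G.edgesWithin S).ncard = (G₁.edgesWithin (D.trace₁ S) \ {e₁}).ncard +
      (G₂.edgesWithin (D.trace₂ S) \ {e₂}).ncard := by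
  have hs₁ : G₁.edgesWithin (D.trace₁ S) \ {e₁} ⊆ G₁.edgeSet \ {e₁} :=
    Set.sdiff_subset_sdiff_left (G₁.edgesWithin_subset _)
  have hs₂ : G₂.edgesWithin (D.trace₂ S) \ {e₂} ⊆ G₂.edgeSet \ {e₂} :=
    Set.sdiff_subset_sdiff_left (G₂.edgesWithin_subset _)
  have h : G.edgesWithin S = D.ψ₁ '' (G₁.edgesWithin (D.trace₁ S) \ {e₁}) ∪
      D.ψ₂ '' (G₂.edgesWithin (D.trace₂ S) \ {e₂}) := by
    ext e
    constructor
    · rintro ⟨x, y, he, hx, hy⟩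
      obtain ⟨f, hf, a, b, hab, rfl, rfl, rfl⟩ | ⟨f, hf, a, b, hab, rfl, rfl, rfl⟩ :=
        D.isLink_cases he
      · exact .inl ⟨f, ⟨⟨a, b, hab, ⟨hab.left_mem, hx⟩, hab.right_mem, hy⟩, hf.2⟩, rfl⟩
      · exact .inr ⟨f, ⟨⟨a, b, hab, ⟨hab.left_mem, hx⟩, hab.right_mem, hy⟩, hf.2⟩, rfl⟩
    · rintro (⟨f, ⟨⟨a, b, hab, ha, hb⟩, hf⟩, rfl⟩ | ⟨f, ⟨⟨a, b, hab, ha, hb⟩, hf⟩, rfl⟩)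
      · exact ⟨_, _, D.map_isLink₁ f ⟨hab.edge_mem, hf⟩ a b hab, ha.2, hb.2⟩
      · exact ⟨_, _, D.map_isLink₂ f ⟨hab.edge_mem, hf⟩ a b hab, ha.2, hb.2⟩
  rw [h, Set.ncard_union_eq (D.edgeSet_disjoint.mono (Set.image_mono hs₁) (Set.image_mono hs₂))
    ((hE₁.subset (hs₁.trans Set.sdiff_subset)).image _)
    ((hE₂.subset (hs₂.trans Set.sdiff_subset)).image _),
    (D.injOn_ψ₁.mono hs₁).ncard_image, (D.injOn_ψ₂.mono hs₂).ncard_image]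

/-- The edge count of a set containing the second side, in terms of its trace on the first. -/
lemma ncard_edgesWithin_of_subset (hE₁ : G₁.edgeSet.Finite) (hE₂ : G₂.edgeSet.Finite) {S : Set α}
    (hS : D.side₂ ⊆ S) :
    (G.edgesWithin S).ncard + 2 =
      (G₁.edgesWithin (D.trace₁ S)).ncard + G₂.edgeSet.ncard := by
  have ht : D.trace₂ S = G₂.vertexSet := Set.inter_eq_left.2 fun x hx ↦ hS ⟨x, hx, rfl⟩
  have hu : D.φ₁ D.u₁ ∈ S := hS ⟨D.u₂, D.isLink₂.left_mem, D.glue_u.symm⟩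
  have hv : D.φ₁ D.v₁ ∈ S := hS ⟨D.v₂, D.isLink₂.right_mem, D.glue_v.symm⟩
  have he₁ : e₁ ∈ G₁.edgesWithin (D.trace₁ S) :=
    ⟨_, _, D.isLink₁, ⟨D.isLink₁.left_mem, hu⟩, D.isLink₁.right_mem, hv⟩
  rw [D.ncard_edgesWithin hE₁ hE₂, ht, edgesWithin_vertexSet]
  have h1 := Set.ncard_sdiff_singleton_add_one he₁ (hE₁.subset (G₁.edgesWithin_subset _))
  have h2 := Set.ncard_sdiff_singleton_add_one D.isLink₂.edge_mem hE₂
  omega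

/-- The edge count of a set in the first side that misses one of the glued vertices. -/
lemma ncard_edgesWithin_of_not (h₂ : G₂.Loopless) (hE₁ : G₁.edgeSet.Finite)
    (hE₂ : G₂.edgeSet.Finite) {S : Set α} (hS : S ⊆ D.side₁)
    (hne : ¬ (D.φ₁ D.u₁ ∈ S ∧ D.φ₁ D.v₁ ∈ S)) :
    (G.edgesWithin S).ncard = (G₁.edgesWithin (D.trace₁ S)).ncard := by
  have he₁ : e₁ ∉ G₁.edgesWithin (D.trace₁ S) := fun h ↦ by
    have := (D.isLink₁.mem_edgesWithin_iff).1 h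
    exact hne ⟨this.1.2, this.2.2⟩
  have ht : (D.trace₂ S).Subsingleton := by
    have key : ∀ x ∈ D.trace₂ S, D.φ₂ x = D.φ₁ D.u₁ ∨ D.φ₂ x = D.φ₁ D.v₁ := by
      rintro x ⟨hx, hxS⟩
      have : D.φ₂ x ∈ D.side₁ ∩ D.side₂ := ⟨hS hxS, x, hx, rfl⟩
      rwa [D.vertexSet_inter] at this
    intro x hx y hy
    refine D.injOn_φ₂ hx.1 hy.1 ?_
    have hx' := hx.2
    have hy' := hy.2
    rw [Set.mem_preimage] at hx' hy'
    obtain h | h := key x hx <;> obtain h' | h' := key y hy <;> rw [h] at hx' <;>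
      rw [h'] at hy'
    exacts [h.trans h'.symm, (hne ⟨hx', hy'⟩).elim, (hne ⟨hy', hx'⟩).elim, h.trans h'.symm]
  rw [D.ncard_edgesWithin hE₁ hE₂, edgesWithin_eq_empty_of_subsingleton h₂ ht,
    Set.sdiff_singleton_eq_self he₁]
  simp

lemma side₁_subset : D.side₁ ⊆ G.vertexSet := D.vertexSet_eq ▸ Set.subset_union_left

lemma side₂_subset : D.side₂ ⊆ G.vertexSet := D.vertexSet_eq ▸ Set.subset_union_right

lemma vertexSet_diff {S : Set α} (hS : S ⊆ D.side₁) :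
    G.vertexSet \ S = D.side₁ \ S ∪ (D.side₂ \ D.side₁) := by
  rw [D.vertexSet_eq]
  ext x
  have := @hS x
  simp only [Set.mem_union, Set.mem_sdiff]
  tauto

lemma twoConnOn_part₁ (D : EdgeGluing G₁ e₁ G₂ e₂ G)
    (h₁ : G₁.Loopless) (h₂ : G₂.Loopless) (hG : G.IsTwoConnected) :
    TwoConnOn G₁.Adj G₁.vertexSet := by
  rw [← D.twoConnOn_iff₁ h₂ subset_rfl]
  refine (D.isTwoSep h₁).twoConnOn_withPair subset_rfl ⟨_, D.isLink₁.left_mem, rfl⟩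
    ⟨_, D.isLink₁.right_mem, rfl⟩ ?_
  rw [← D.vertexSet_eq]
  exact (isTwoConnected_iff.1 hG).2

lemma isTwoConnected_part₁ (D : EdgeGluing G₁ e₁ G₂ e₂ G)
    (h₁ : G₁.Loopless) (h₂ : G₂.Loopless) (hG : G.IsTwoConnected) :
    G₁.IsTwoConnected :=
  isTwoConnected_iff.2 ⟨h₁, D.twoConnOn_part₁ h₁ h₂ hG⟩

/-- The equality at a good flat of the glued graph that lies on the first side and misses a glued
vertex. -/
lemma flat_of_subset_side₁ (hG₁ : G₁.IsTwoConnected) (h₂ : G₂.Loopless)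
    (hE₁ : G₁.edgeSet.Finite) (hE₂ : G₂.edgeSet.Finite) (hs : G₁.UnitSpade) {S : Set α}
    (hS : S ⊆ D.side₁) (hne : ¬ (D.φ₁ D.u₁ ∈ S ∧ D.φ₁ D.v₁ ∈ S)) (hc : TwoConnOn G.Adj S)
    (hd : ConnOn G.Adj (G.vertexSet \ S)) :
    (G.edgesWithin S).ncard + 1 = 2 * (S.ncard - 1) := by
  have h₁ := hG₁.loopless
  have hu : D.φ₁ D.u₁ ∈ D.side₁ := ⟨_, D.isLink₁.left_mem, rfl⟩
  have hv : D.φ₁ D.v₁ ∈ D.side₁ := ⟨_, D.isLink₁.right_mem, rfl⟩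
  have himg := D.image_trace₁ hS
  have hdi : D.φ₁ '' (G₁.vertexSet \ D.trace₁ S) = D.side₁ \ S := by
    rw [D.injOn_φ₁.image_sdiff_subset Set.inter_subset_left, himg]
  have hne' : D.φ₁ D.u₁ ∈ D.side₁ \ S ∨ D.φ₁ D.v₁ ∈ D.side₁ \ S := by
    simp only [Set.mem_sdiff]
    tauto
  have hss : D.trace₁ S ⊂ G₁.vertexSet := by
    refine ⟨Set.inter_subset_left, fun h ↦ ?_⟩
    rw [Set.sdiff_eq_empty.2 h, Set.image_empty] at hdi
    simp [← hdi] at hne'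
  rw [D.ncard_edgesWithin_of_not h₂ hE₁ hE₂ hS hne, hs.2 _ hss, ← himg,
    (D.injOn_φ₁.mono Set.inter_subset_left).ncard_image, himg]
  · rw [← D.twoConnOn_iff₁ h₂ Set.inter_subset_left, himg]
    exact hc.mono fun _ _ _ _ h ↦ .inl h
  · rw [← D.connOn_iff₁ h₂ Set.sdiff_subset, hdi]
    rw [D.vertexSet_diff hS] at hd
    exact (D.isTwoSep h₁).connOn_withPair Set.sdiff_subset hne' hd

lemma trace₁_ncard_add (D : EdgeGluing G₁ e₁ G₂ e₂ G) (h₁ : G₁.Loopless) (hV₁ : G₁.vertexSet.Finite)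
    (hV₂ : G₂.vertexSet.Finite) {S : Set α} (hS : S ⊆ G.vertexSet) (hB : D.side₂ ⊆ S) :
    S.ncard + 2 = (D.trace₁ S).ncard + G₂.vertexSet.ncard := by
  have hSf := (D.finite_vertexSet hV₁ hV₂).subset hS
  have h1 : D.φ₁ '' D.trace₁ S = D.side₁ ∩ S := Set.image_inter_preimage ..
  have h2 : D.side₁ ∩ S ∪ D.side₂ = S := by
    ext x
    have h1 := @hS x
    have h2 := @hB x
    rw [D.vertexSet_eq] at h1
    simp only [Set.mem_union, Set.mem_inter_iff] at *
    tauto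
  have h3 : (D.side₁ ∩ S) ∩ D.side₂ = {D.φ₁ D.u₁, D.φ₁ D.v₁} := by
    rw [← D.vertexSet_inter]
    ext x
    have h2 := @hB x
    simp only [Set.mem_inter_iff] at *
    tauto
  have := Set.ncard_union_add_ncard_inter (D.side₁ ∩ S) D.side₂
    (hSf.subset Set.inter_subset_right) (hV₂.image _)
  rwa [h2, h3, Set.ncard_pair (D.u_ne_v h₁), ← h1,
    (D.injOn_φ₁.mono Set.inter_subset_left).ncard_image, D.injOn_φ₂.ncard_image] at this

/-- The equality at a good flat of the glued graph that contains the second side. -/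
lemma flat_of_side₂_subset (hG₁ : G₁.IsTwoConnected) (hG₂ : G₂.IsTwoConnected)
    (hV₁ : G₁.vertexSet.Finite) (hV₂ : G₂.vertexSet.Finite)
    (hE₁ : G₁.edgeSet.Finite) (hE₂ : G₂.edgeSet.Finite) (hs₁ : G₁.UnitSpade)
    (hs₂ : G₂.UnitSpade) {S : Set α} (hSV : S ⊂ G.vertexSet)
    (hB : D.side₂ ⊆ S) (hc : TwoConnOn G.Adj S) (hd : ConnOn G.Adj (G.vertexSet \ S)) :
    (G.edgesWithin S).ncard + 1 = 2 * (S.ncard - 1) := by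
  have h₁ := hG₁.loopless
  have h₂ := hG₂.loopless
  have hu : D.φ₁ D.u₁ ∈ S := hB ⟨D.u₂, D.isLink₂.left_mem, D.glue_u.symm⟩
  have hv : D.φ₁ D.v₁ ∈ S := hB ⟨D.v₂, D.isLink₂.right_mem, D.glue_v.symm⟩
  have himg : D.φ₁ '' D.trace₁ S = D.side₁ ∩ S := Set.image_inter_preimage ..
  have hdi : D.φ₁ '' (G₁.vertexSet \ D.trace₁ S) = G.vertexSet \ S := by
    rw [D.injOn_φ₁.image_sdiff_subset Set.inter_subset_left, himg, D.vertexSet_eq]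
    ext x
    have := @hB x
    simp only [Set.mem_sdiff, Set.mem_union, Set.mem_inter_iff]
    tauto
  have hun : D.side₁ ∩ S ∪ D.side₂ = S := by
    ext x
    have h1 := @hSV.1 x
    have h2 := @hB x
    rw [D.vertexSet_eq] at h1
    simp only [Set.mem_union, Set.mem_inter_iff] at *
    tauto
  have hss : D.trace₁ S ⊂ G₁.vertexSet := by
    refine ⟨Set.inter_subset_left, fun h ↦ ?_⟩
    rw [Set.sdiff_eq_empty.2 h, Set.image_empty] at hdi
    exact hd.1.ne_empty hdi.symm
  have hc₁ : TwoConnOn G₁.Adj (D.trace₁ S) := by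
    rw [← D.twoConnOn_iff₁ h₂ Set.inter_subset_left, himg]
    refine (D.isTwoSep h₁).twoConnOn_withPair Set.inter_subset_left
      ⟨⟨_, D.isLink₁.left_mem, rfl⟩, hu⟩ ⟨⟨_, D.isLink₁.right_mem, rfl⟩, hv⟩ ?_
    rwa [hun]
  have hd₁ : ConnOn G₁.Adj (G₁.vertexSet \ D.trace₁ S) := by
    rw [← D.connOn_iff₁ h₂ Set.sdiff_subset, hdi]
    exact hd.mono fun _ _ _ _ h ↦ .inl h
  have hflat := hs₁.2 _ hss hc₁ hd₁
  have hcard := hs₂.1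
  have hn := D.trace₁_ncard_add h₁ hV₁ hV₂ hSV.1 hB
  have hi := D.ncard_edgesWithin_of_subset hE₁ hE₂ hB
  have h2 : 1 < G₂.vertexSet.ncard := (Set.one_lt_ncard hV₂).2 hG₂.nontrivial
  have h3 : 1 < (D.trace₁ S).ncard :=
    (Set.one_lt_ncard (hV₁.subset Set.inter_subset_left)).2 hc₁.1
  omega

/-- Gluing preserves the equalities. -/
theorem unitSpade (D : EdgeGluing G₁ e₁ G₂ e₂ G) (hG₁ : G₁.IsTwoConnected) (hG₂ : G₂.IsTwoConnected)
    (hV₁ : G₁.vertexSet.Finite) (hV₂ : G₂.vertexSet.Finite)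
    (hE₁ : G₁.edgeSet.Finite) (hE₂ : G₂.edgeSet.Finite) (hs₁ : G₁.UnitSpade)
    (hs₂ : G₂.UnitSpade) : G.UnitSpade := by
  have h₁ := hG₁.loopless
  have hsep := D.isTwoSep h₁
  have hn1 : 1 < G₁.vertexSet.ncard := (Set.one_lt_ncard hV₁).2 hG₁.nontrivial
  have hn2 : 1 < G₂.vertexSet.ncard := (Set.one_lt_ncard hV₂).2 hG₂.nontrivial
  refine ⟨?_, fun S hS hc hd ↦ ?_⟩
  · have hi := D.ncard_edgesWithin_of_subset hE₁ hE₂ D.side₂_subset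
    have ht : D.trace₁ G.vertexSet = G₁.vertexSet :=
      Set.inter_eq_left.2 fun x hx ↦ D.side₁_subset ⟨x, hx, rfl⟩
    rw [ht, edgesWithin_vertexSet, edgesWithin_vertexSet, hs₁.1, hs₂.1] at hi
    have := D.ncard_vertexSet_add h₁ hV₁ hV₂
    omega
  · by_cases huv : D.φ₁ D.u₁ ∈ S ∧ D.φ₁ D.v₁ ∈ S
    · obtain h | h := hsep.subset_or_subset_of_connOn
        (D.vertexSet_eq ▸ Set.sdiff_subset) hd (fun h ↦ h.2 huv.1) (fun h ↦ h.2 huv.2)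
      · refine D.flat_of_side₂_subset hG₁ hG₂ hV₁ hV₂ hE₁ hE₂ hs₁ hs₂ hS (fun x hx ↦ ?_) hc hd
        by_contra hxS
        have hxA := h ⟨D.side₂_subset hx, hxS⟩
        obtain rfl | rfl := (hsep.inter x).1 ⟨hxA, hx⟩
        exacts [hxS huv.1, hxS huv.2]
      · refine D.swap.flat_of_side₂_subset hG₂ hG₁ hV₂ hV₁ hE₂ hE₁ hs₂ hs₁ hS (fun x hx ↦ ?_)
          hc hd
        by_contra hxS
        have hxB := h ⟨D.side₁_subset hx, hxS⟩
        obtain rfl | rfl := (hsep.inter x).1 ⟨hx, hxB⟩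
        exacts [hxS huv.1, hxS huv.2]
    · obtain h | h := hsep.subset_or_subset (D.vertexSet_eq ▸ hS.1) hc huv
      · exact D.flat_of_subset_side₁ hG₁ hG₂.loopless hE₁ hE₂ hs₁ h huv hc hd
      · refine D.swap.flat_of_subset_side₁ hG₂ h₁ hE₂ hE₁ hs₂ h ?_ hc hd
        change ¬ (D.φ₂ D.u₂ ∈ S ∧ D.φ₂ D.v₂ ∈ S)
        rwa [← D.glue_u, ← D.glue_v]

/-- The equalities pass from the glued graph to its parts, provided that the parts have the right
numbers of edges and the glued vertices are not adjacent in the glued graph. -/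
theorem unitSpade_part₁ (hG₁ : G₁.IsTwoConnected)
    (hG₂ : G₂.IsTwoConnected) (hV₁ : G₁.vertexSet.Finite) (hV₂ : G₂.vertexSet.Finite)
    (hE₁ : G₁.edgeSet.Finite) (hE₂ : G₂.edgeSet.Finite) (hs : G.UnitSpade)
    (hc₁ : G₁.edgeSet.ncard = 2 * (G₁.vertexSet.ncard - 1))
    (hc₂ : G₂.edgeSet.ncard = 2 * (G₂.vertexSet.ncard - 1))
    (hadj : ¬ G.Adj (D.φ₁ D.u₁) (D.φ₁ D.v₁)) (h3 : 2 < G₂.vertexSet.ncard) :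
    G₁.UnitSpade := by
  have h₁ := hG₁.loopless
  have h₂ := hG₂.loopless
  have hsep := D.isTwoSep h₁
  have huA : D.φ₁ D.u₁ ∈ D.side₁ := ⟨_, D.isLink₁.left_mem, rfl⟩
  have hvA : D.φ₁ D.v₁ ∈ D.side₁ := ⟨_, D.isLink₁.right_mem, rfl⟩
  have huB := ((hsep.inter _).2 (.inl rfl)).2
  have hvB := ((hsep.inter _).2 (.inr rfl)).2
  have hBw : ∃ w ∈ D.side₂, w ≠ D.φ₁ D.u₁ ∧ w ≠ D.φ₁ D.v₁ := by
    by_contra! hcon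
    have hsub : D.side₂ ⊆ {D.φ₁ D.u₁, D.φ₁ D.v₁} := fun w hw ↦ by
      by_cases h : w = D.φ₁ D.u₁
      exacts [.inl h, .inr (hcon w hw h)]
    have := Set.ncard_le_ncard hsub
    rw [Set.ncard_pair (D.u_ne_v h₁), D.injOn_φ₂.ncard_image] at this
    omega
  have hBc : TwoConnOn D.adj D.side₂ :=
    (D.twoConnOn_iff₂ h₁ subset_rfl).2 (isTwoConnected_iff.1 hG₂).2
  refine ⟨hc₁, fun S hS hc hd ↦ ?_⟩
  set T := D.φ₁ '' S with hT
  have hTA : T ⊆ D.side₁ := Set.image_mono hS.1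
  have hTS : D.trace₁ T = S := by
    ext x
    constructor
    · rintro ⟨hx, y, hy, hyx⟩
      exact D.injOn_φ₁ (hS.1 hy) hx hyx ▸ hy
    · exact fun hx ↦ ⟨hS.1 hx, x, hx, rfl⟩
  have hTn : T.ncard = S.ncard := (D.injOn_φ₁.mono hS.1).ncard_image
  have hcT : TwoConnOn D.adj T := (D.twoConnOn_iff₁ h₂ hS.1).2 hc
  have hdT : ConnOn D.adj (D.side₁ \ T) := by
    rw [hT, ← D.injOn_φ₁.image_sdiff_subset hS.1]
    exact (D.connOn_iff₁ h₂ Set.sdiff_subset).2 hd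
  obtain ⟨t, htA, htT⟩ := hdT.1
  by_cases huv : D.φ₁ D.u₁ ∈ T ∧ D.φ₁ D.v₁ ∈ T
  · by_cases hTw : ∃ w ∈ T, w ≠ D.φ₁ D.u₁ ∧ w ≠ D.φ₁ D.v₁
    · -- The union of `T` and the second side is a good flat of the glued graph.
      have hTB := hsep.twoConnOn_union hTA huv.1 huv.2 hTw hBw hcT hBc
      have htB : t ∉ D.side₂ := fun h ↦ by
        obtain rfl | rfl := (hsep.inter t).1 ⟨htA, h⟩
        exacts [htT huv.1, htT huv.2]
      have hss : T ∪ D.side₂ ⊂ G.vertexSet :=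
        ⟨Set.union_subset (hTA.trans D.side₁_subset) D.side₂_subset,
          fun h ↦ (h (D.side₁_subset htA)).elim htT htB⟩
      have hdi : G.vertexSet \ (T ∪ D.side₂) = D.side₁ \ T := by
        rw [D.vertexSet_eq]
        ext x
        have := hsep.inter x
        simp only [Set.mem_sdiff, Set.mem_union]
        grind
      have hflat := hs.2 _ hss hTB (by
        rw [hdi]
        refine hdT.mono fun x hx y hy hxy ↦ ?_
        obtain h | ⟨rfl, rfl⟩ | ⟨rfl, rfl⟩ := hxy
        exacts [h, (hx.2 huv.1).elim, (hy.2 huv.1).elim])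
      have htr : D.trace₁ (T ∪ D.side₂) = S := by
        rw [← hTS]
        ext x
        refine and_congr_right fun hx ↦ ⟨fun h ↦ h.elim id fun h ↦ ?_, .inl⟩
        obtain h | h := (hsep.inter _).1 ⟨⟨x, hx, rfl⟩, h⟩
        · exact Set.mem_preimage.2 (h ▸ huv.1)
        · exact Set.mem_preimage.2 (h ▸ huv.2)
      have hi := D.ncard_edgesWithin_of_subset hE₁ hE₂ (S := T ∪ D.side₂) Set.subset_union_right
      have hn := D.trace₁_ncard_add h₁ hV₁ hV₂ hss.1 Set.subset_union_right
      rw [htr] at hi hn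
      have h4 : 1 < S.ncard := (Set.one_lt_ncard (hV₁.subset hS.1)).2 hc.1
      omega
    · -- Here `T` consists of the glued vertices, which are joined in `G₁` by `e₁` only.
      have hTuv : T = {D.φ₁ D.u₁, D.φ₁ D.v₁} := by
        push Not at hTw
        refine subset_antisymm (fun w hw ↦ ?_) (by rintro w (rfl | rfl); exacts [huv.1, huv.2])
        by_cases h : w = D.φ₁ D.u₁
        exacts [.inl h, .inr (hTw w hw h)]
      have hS2 : S.ncard = 2 := by rw [← hTn, hTuv, Set.ncard_pair (D.u_ne_v h₁)]
      have hE : G₁.edgesWithin S = {e₁} := by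
        refine subset_antisymm ?_ ?_
        · rintro e ⟨x, y, he, hx, hy⟩
          by_contra hee
          have hl := D.map_isLink₁ e ⟨he.edge_mem, hee⟩ x y he
          have hx' : D.φ₁ x ∈ T := ⟨x, hx, rfl⟩
          have hy' : D.φ₁ y ∈ T := ⟨y, hy, rfl⟩
          have hxy : D.φ₁ x ≠ D.φ₁ y := fun h ↦ by
            obtain rfl := D.injOn_φ₁ he.left_mem he.right_mem h
            exact h₁.not_isLoopAt e x he
          rw [hTuv] at hx' hy'
          obtain hx' | hx' := hx' <;> obtain hy' | hy' := hy'
          · exact hxy (hx'.trans hy'.symm)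
          · exact hadj (hx' ▸ hy' ▸ hl.adj)
          · exact hadj (hx' ▸ hy' ▸ hl.symm.adj)
          · exact hxy (hx'.trans hy'.symm)
        · rintro _ rfl
          rw [← hTS]
          exact ⟨_, _, D.isLink₁, ⟨D.isLink₁.left_mem, huv.1⟩, D.isLink₁.right_mem, huv.2⟩
      rw [hE, hS2, Set.ncard_singleton]
  · have hcT' : TwoConnOn G.Adj T := (twoConnOn_withPair_iff_of_not huv).1 hcT
    have hd' : ConnOn G.Adj (G.vertexSet \ T) := by
      obtain ⟨hB0, hBu, hBv⟩ := hBc.connOn_of_withPair huB hvB hsep.ne hBw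
      rw [D.vertexSet_diff hTA]
      refine hsep.connOn_of_withPair Set.sdiff_subset ?_ hB0 hBu hBv hdT
      simp only [Set.mem_sdiff]
      tauto
    have := hs.2 T ⟨hTA.trans D.side₁_subset, fun h ↦ htT (h (D.side₁_subset htA))⟩ hcT' hd'
    rwa [D.ncard_edgesWithin_of_not h₂ hE₁ hE₂ hTA huv, hTS, hTn] at this

end EdgeGluing

end Gluing

/-! ### Base cases and the decomposition -/

section Small

variable {α : Type u} {β : Type v} {G : Graph α β}

/-- The unordered pair of ends as a function of the edge; off the edge set its values are
arbitrary. -/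
lemma exists_ends (G : Graph α β) [Nonempty α] :
    ∃ f : β → Sym2 α, ∀ e x y, G.IsLink e x y → f e = s(x, y) := by
  classical
  obtain ⟨a⟩ := ‹Nonempty α›
  have h : ∀ e, ∃ p : Sym2 α, ∀ x y, G.IsLink e x y → p = s(x, y) := by
    intro e
    by_cases he : ∃ x y, G.IsLink e x y
    · obtain ⟨x, y, hxy⟩ := he
      exact ⟨s(x, y), fun x' y' h ↦ (hxy.isLink_iff_sym2_eq).1 h⟩
    · exact ⟨s(a, a), fun x y h ↦ (he ⟨x, y, h⟩).elim⟩
  choose f hf using h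
  exact ⟨f, hf⟩

open Classical in
lemma Simple.image_edgesWithin_subset (hG : G.Simple) {f : β → Sym2 α}
    (hf : ∀ e x y, G.IsLink e x y → f e = s(x, y)) (s : Finset α) :
    f '' G.edgesWithin s ⊆ s.offDiag.image (fun p ↦ s(p.1, p.2)) := by
  rintro _ ⟨e, ⟨x, y, he, hx, hy⟩, rfl⟩
  rw [hf e x y he, Finset.mem_coe, Finset.mem_image]
  refine ⟨(x, y), Finset.mem_offDiag.2 ⟨hx, hy, ?_⟩, rfl⟩
  intro (hxy : x = y)
  exact G.not_adj_self x (hxy ▸ he.adj)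

lemma Simple.injOn_ends (hG : G.Simple) {f : β → Sym2 α}
    (hf : ∀ e x y, G.IsLink e x y → f e = s(x, y)) : Set.InjOn f G.edgeSet := by
  intro e he e' he' h
  obtain ⟨x, y, hxy⟩ := exists_isLink_of_mem_edgeSet he
  obtain ⟨x', y', hxy'⟩ := exists_isLink_of_mem_edgeSet he'
  rw [hf e x y hxy, hf e' x' y' hxy'] at h
  exact hG.eq_of_isLink hxy (hxy'.isLink_iff_sym2_eq.2 h.symm)

open Classical in
lemma IsCompleteFour.ncard_edgesWithin (hG : G.IsCompleteFour) (s : Finset α)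
    (hs : (s : Set α) ⊆ G.vertexSet) :
    (G.edgesWithin s).Finite ∧ (G.edgesWithin s).ncard = s.card.choose 2 := by
  obtain ⟨hsim, h4, hadj⟩ := hG
  have : Nonempty α := by
    by_contra h
    rw [not_nonempty_iff] at h
    simp [Set.eq_empty_of_isEmpty] at h4
  obtain ⟨f, hf⟩ := G.exists_ends
  have himg : f '' G.edgesWithin s = s.offDiag.image (fun p ↦ s(p.1, p.2)) := by
    refine (hsim.image_edgesWithin_subset hf s).antisymm fun p hp ↦ ?_
    obtain ⟨⟨x, y⟩, hxy, rfl⟩ := Finset.mem_image.1 hp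
    obtain ⟨hx, hy, hne⟩ := Finset.mem_offDiag.1 hxy
    obtain ⟨e, he⟩ := hadj x (hs hx) y (hs hy) hne
    exact ⟨e, ⟨x, y, he, hx, hy⟩, hf e x y he⟩
  have hinj := (hsim.injOn_ends hf).mono (G.edgesWithin_subset s)
  refine ⟨Set.Finite.of_finite_image (himg ▸ Finset.finite_toSet _) hinj, ?_⟩
  rw [← hinj.ncard_image, himg, Set.ncard_coe_finset]
  exact Sym2.card_image_offDiag s

lemma IsCompleteFour.finite_unitSpade (hG : G.IsCompleteFour) :
    G.vertexSet.Finite ∧ G.edgeSet.Finite ∧ G.UnitSpade := by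
  have h4 := hG.2.1
  have hV : G.vertexSet.Finite := Set.finite_of_ncard_ne_zero (by omega)
  have key : ∀ S ⊆ G.vertexSet,
      (G.edgesWithin S).Finite ∧ (G.edgesWithin S).ncard = S.ncard.choose 2 := by
    intro S hS
    obtain ⟨s, rfl⟩ := (hV.subset hS).exists_finset_coe
    rw [Set.ncard_coe_finset]
    exact hG.ncard_edgesWithin s hS
  have hE := key _ subset_rfl
  rw [edgesWithin_vertexSet, h4] at hE
  refine ⟨hV, hE.1, by rw [hE.2, h4]; rfl, fun S hS hc _ ↦ ?_⟩
  have h2 := (Set.one_lt_ncard (hV.subset hS.1)).2 hc.1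
  have h3 := Set.ncard_lt_ncard hS hV
  rw [(key S hS.1).2]
  obtain h | h : S.ncard = 2 ∨ S.ncard = 3 := by omega
  all_goals rw [h]; rfl

lemma IsTwoCycle.unitSpade (hG : G.IsTwoCycle) : G.UnitSpade := by
  obtain ⟨x, y, hxy, F, hF, rfl⟩ := hG
  have hV : (banana x y F).vertexSet = {x, y} := rfl
  have hfin : ({x, y} : Set α).Finite := Set.toFinite _
  refine ⟨by rw [hV, Set.ncard_pair hxy]; exact hF, fun S hS hc _ ↦ ?_⟩
  rw [hV] at hS
  have h3 := Set.ncard_lt_ncard hS hfin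
  have h2 := (Set.one_lt_ncard (hfin.subset hS.1)).2 hc.1
  rw [Set.ncard_pair hxy] at h3
  omega

lemma UnitSpade.isTwoCycle (hs : G.UnitSpade) (hl : G.Loopless) (h2 : G.vertexSet.ncard = 2) :
    G.IsTwoCycle := by
  obtain ⟨x, y, hxy, hV⟩ := Set.ncard_eq_two.1 h2
  refine ⟨x, y, hxy, G.edgeSet, by rw [hs.1, h2], Graph.ext hV fun e a b ↦ ?_⟩
  have key : ∀ a b, G.IsLink e a b → (a = x ∧ b = y) ∨ (a = y ∧ b = x) := by
    intro a b h
    have ha := h.left_mem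
    have hb := h.right_mem
    have hab : a ≠ b := by
      rintro rfl
      exact hl.not_isLoopAt e a h
    rw [hV] at ha hb
    obtain rfl | rfl := ha <;> obtain rfl | rfl := hb
    exacts [(hab rfl).elim, .inl ⟨rfl, rfl⟩, .inr ⟨rfl, rfl⟩, (hab rfl).elim]
  refine ⟨fun h ↦ ⟨h.edge_mem, key a b h⟩, fun ⟨he, hab⟩ ↦ ?_⟩
  obtain ⟨a', b', h⟩ := exists_isLink_of_mem_edgeSet he
  obtain ⟨rfl, rfl⟩ | ⟨rfl, rfl⟩ := key a' b' h <;> obtain ⟨rfl, rfl⟩ | ⟨rfl, rfl⟩ := hab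
  exacts [h, h.symm, h.symm, h]

lemma UnitSpade.simple (hs : G.UnitSpade) (hV : G.vertexSet.Finite) (hE : G.edgeSet.Finite)
    (hG : G.IsTwoConnected) (h3 : 3 ≤ G.vertexSet.ncard) : G.Simple := by
  refine { hG.loopless with eq_of_isLink := fun e f x y he hf ↦ ?_ }
  have hxy : x ≠ y := by
    rintro rfl
    exact hG.loopless.not_isLoopAt e x he
  have hsub : {x, y} ⊆ G.vertexSet := by
    rintro z (rfl | rfl)
    exacts [he.left_mem, he.right_mem]
  have hcard := Set.ncard_pair hxy
  have hle := hs.ncard_edgesWithin_le hV hE hG (S := {x, y})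
    (hsub.ssubset_of_ne fun h ↦ by rw [h] at hcard; omega) hcard.ge
  have h1 : (G.edgesWithin {x, y}).ncard ≤ 1 := by omega
  exact (Set.ncard_le_one (hE.subset (G.edgesWithin_subset _))).1 h1 _
    ⟨x, y, he, by simp, by simp⟩ _ ⟨x, y, hf, by simp, by simp⟩

open Classical in
/-- Handshake lemma: counting the edges at each vertex counts every edge twice. -/
lemma sum_ncard_inc (hl : G.Loopless) (hV : G.vertexSet.Finite) (hE : G.edgeSet.Finite) :
    ∑ x ∈ hV.toFinset, {e | G.Inc e x}.ncard = 2 * G.edgeSet.ncard := by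
  have h1 : ∀ x ∈ hV.toFinset, {e | G.Inc e x}.ncard =
      (hE.toFinset.bipartiteAbove (fun x e ↦ G.Inc e x) x).card := by
    intro x _
    rw [← Set.ncard_coe_finset]
    congr 1
    ext e
    simp only [Set.mem_ofPred_eq, Finset.coe_bipartiteAbove, Set.Finite.mem_toFinset]
    exact ⟨fun h ↦ ⟨h.edge_mem, h⟩, fun h ↦ h.2⟩
  have h2 : ∀ e ∈ hE.toFinset,
      (hV.toFinset.bipartiteBelow (fun x e ↦ G.Inc e x) e).card = 2 := by
    intro e he
    obtain ⟨x, y, hxy⟩ := exists_isLink_of_mem_edgeSet (hE.mem_toFinset.1 he)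
    have hne : x ≠ y := by
      rintro rfl
      exact hl.not_isLoopAt e x hxy
    rw [← Finset.card_pair hne]
    congr 1
    ext z
    simp only [Finset.mem_bipartiteBelow, Set.Finite.mem_toFinset, Finset.mem_insert,
      Finset.mem_singleton]
    constructor
    · exact fun h ↦ h.2.eq_or_eq_of_isLink hxy
    · rintro (rfl | rfl)
      exacts [⟨hxy.left_mem, hxy.inc_left⟩, ⟨hxy.right_mem, hxy.inc_right⟩]
  rw [Finset.sum_congr rfl h1, Finset.sum_card_bipartiteAbove_eq_sum_card_bipartiteBelow,
    Finset.sum_congr rfl h2, Finset.sum_const, smul_eq_mul, mul_comm,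
    Set.ncard_eq_toFinset_card _ hE]

/-- If no two vertices separate `G`, then the complement of each vertex is a good flat. The
equalities there say that `G` is cubic, so that `3 |V| = 2 |E| = 4 (|V| - 1)`. -/
lemma UnitSpade.isCompleteFour (hs : G.UnitSpade) (hV : G.vertexSet.Finite)
    (hE : G.edgeSet.Finite) (hG : G.IsTwoConnected) (h3 : 3 ≤ G.vertexSet.ncard)
    (hc : ∀ x ∈ G.vertexSet, ∀ y ∈ G.vertexSet \ {x},
      ConnOn G.Adj ((G.vertexSet \ {x}) \ {y})) : G.IsCompleteFour := by
  classical
  obtain ⟨hl, hG2⟩ := isTwoConnected_iff.1 hG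
  have hdeg : ∀ x ∈ hV.toFinset, {e | G.Inc e x}.ncard = 3 := by
    intro x hx
    rw [Set.Finite.mem_toFinset] at hx
    have hn := Set.ncard_sdiff_singleton_add_one hx hV
    have hflat := hs.2 (G.vertexSet \ {x}) ⟨Set.sdiff_subset, fun h ↦ (h hx).2 rfl⟩
      ⟨(Set.one_lt_ncard (hV.subset Set.sdiff_subset)).1 (by omega), hG2.2.2 x hx, hc x hx⟩ (by
        rw [Set.sdiff_sdiff_cancel_left (by simpa using hx)]
        exact ⟨⟨x, rfl⟩, fun P _ ⟨y, hy, hPy⟩ z hz ↦ by rwa [hz, ← show y = x from hy]⟩)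
    have hinc : {e | G.Inc e x} = G.edgeSet \ G.edgesWithin (G.vertexSet \ {x}) := by
      ext e
      constructor
      · rintro ⟨y, hxy⟩
        exact ⟨hxy.edge_mem, fun h ↦ (hxy.mem_edgesWithin_iff.1 h).1.2 rfl⟩
      · rintro ⟨he, hnot⟩
        obtain ⟨y, z, hyz⟩ := exists_isLink_of_mem_edgeSet he
        rw [hyz.mem_edgesWithin_iff] at hnot
        by_cases hyx : y = x
        · exact hyx ▸ hyz.inc_left
        by_cases hzx : z = x
        · exact hzx ▸ hyz.inc_right
        exact (hnot ⟨⟨hyz.left_mem, hyx⟩, hyz.right_mem, hzx⟩).elim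
    have hsub := G.edgesWithin_subset (G.vertexSet \ {x})
    have h1 := Set.ncard_sdiff_add_ncard_of_subset hsub hE
    have h2 := hs.1
    rw [hinc]
    omega
  have h4 : G.vertexSet.ncard = 4 := by
    have := sum_ncard_inc hl hV hE
    rw [Finset.sum_congr rfl hdeg, Finset.sum_const, smul_eq_mul,
      ← Set.ncard_eq_toFinset_card _ hV, hs.1] at this
    omega
  have hsim := hs.simple hV hE hG h3
  refine ⟨hsim, h4, fun x hx y hy hxy ↦ ?_⟩
  -- The six edges occupy all six pairs of vertices.
  have : Nonempty α := ⟨x⟩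
  obtain ⟨f, hf⟩ := G.exists_ends
  have hsub := hsim.image_edgesWithin_subset hf hV.toFinset
  rw [hV.coe_toFinset, edgesWithin_vertexSet] at hsub
  have heq := Set.eq_of_subset_of_ncard_le hsub (by
    rw [Set.ncard_coe_finset, show (hV.toFinset.offDiag.image (fun p ↦ s(p.1, p.2))).card = _ from
      Sym2.card_image_offDiag _, (hsim.injOn_ends hf).ncard_image, hs.1,
      ← Set.ncard_eq_toFinset_card _ hV, h4]
    rfl) (Finset.finite_toSet _)
  have hmem : s(x, y) ∈ f '' G.edgeSet := by
    rw [heq, Finset.mem_coe, Finset.mem_image]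
    exact ⟨(x, y), Finset.mem_offDiag.2 ⟨by simpa using hx, by simpa using hy, hxy⟩, rfl⟩
  obtain ⟨e, he, hexy⟩ := hmem
  obtain ⟨a, b, hab⟩ := exists_isLink_of_mem_edgeSet he
  rw [hf e a b hab] at hexy
  exact ⟨e, hab.isLink_iff_sym2_eq.2 hexy⟩

end Small

section Split

variable {α : Type u} {β : Type v} {G : Graph α β} {A B : Set α} {u v : α}

/-- The part of `G` on the vertex set `A`, with an additional edge labelled `f` from `u` to `v`.
(An edge of `G` with the label `f` is dropped.) -/
def sideGraph (G : Graph α β) (A : Set α) (f : β) {u v : α} (hu : u ∈ A) (hv : v ∈ A) :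
    Graph α β where
  vertexSet := A
  IsLink e x y := (e ≠ f ∧ G.IsLink e x y ∧ x ∈ A ∧ y ∈ A) ∨
    (e = f ∧ ((x = u ∧ y = v) ∨ (x = v ∧ y = u)))
  isLink_symm e _ := ⟨fun x y h ↦ by
    have := G.isLink_comm (e := e) (x := x) (y := y)
    tauto⟩
  eq_or_eq_of_isLink_of_isLink e x y z w h h' := by
    obtain ⟨he, h, -⟩ | ⟨he, h⟩ := h <;> obtain ⟨he', h', -⟩ | ⟨he', h'⟩ := h'
    · exact h.left_eq_or_eq h'
    · exact (he he').elim
    · exact (he' he).elim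
    · grind
  left_mem_of_isLink e x y h := by
    obtain ⟨-, -, h, -⟩ | ⟨-, ⟨rfl, -⟩ | ⟨rfl, -⟩⟩ := h
    exacts [h, hu, hv]

lemma sideGraph_edgeSet {f : β} (hf : f ∉ G.edgesWithin A) (hu : u ∈ A) (hv : v ∈ A) :
    (G.sideGraph A f hu hv).edgeSet = insert f (G.edgesWithin A) := by
  ext e
  constructor
  · rintro ⟨x, y, ⟨-, h, hx, hy⟩ | ⟨rfl, -⟩⟩
    exacts [.inr ⟨x, y, h, hx, hy⟩, .inl rfl]
  · rintro (rfl | ⟨x, y, h, hx, hy⟩)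
    · exact ⟨u, v, .inr ⟨rfl, .inl ⟨rfl, rfl⟩⟩⟩
    · exact ⟨x, y, .inl ⟨fun he ↦ hf ⟨x, y, he ▸ h, hx, hy⟩, h, hx, hy⟩⟩

lemma sideGraph_loopless (hl : G.Loopless) {f : β} (hu : u ∈ A) (hv : v ∈ A) (huv : u ≠ v) :
    (G.sideGraph A f hu hv).Loopless := by
  refine ⟨?_⟩
  rintro e x (⟨-, h, -⟩ | ⟨-, ⟨h, h'⟩ | ⟨h, h'⟩⟩)
  exacts [hl.not_isLoopAt e x h, huv (h ▸ h'), huv (h' ▸ h)]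

/-- A graph with a 2-separation without an edge between the separating vertices is the gluing of
the two sides. -/
def sideGluing (h : IsTwoSep G.Adj A B u v) (hAB : A ∪ B = G.vertexSet) {f₁ f₂ : β}
    (hf₁ : f₁ ∉ G.edgesWithin A) (hf₂ : f₂ ∉ G.edgesWithin B)
    (hdisj : Disjoint (G.edgesWithin A) (G.edgesWithin B))
    (huA : u ∈ A) (hvA : v ∈ A) (huB : u ∈ B) (hvB : v ∈ B) :
    EdgeGluing (G.sideGraph A f₁ huA hvA) f₁ (G.sideGraph B f₂ huB hvB) f₂ G where
  u₁ := u
  v₁ := v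
  u₂ := u
  v₂ := v
  isLink₁ := .inr ⟨rfl, .inl ⟨rfl, rfl⟩⟩
  isLink₂ := .inr ⟨rfl, .inl ⟨rfl, rfl⟩⟩
  φ₁ := id
  φ₂ := id
  injOn_φ₁ := Set.injOn_id _
  injOn_φ₂ := Set.injOn_id _
  glue_u := rfl
  glue_v := rfl
  vertexSet_inter := by
    rw [Set.image_id, Set.image_id]
    exact Set.ext h.inter
  vertexSet_eq := by
    rw [Set.image_id, Set.image_id]
    exact hAB.symm
  ψ₁ := id
  ψ₂ := id
  injOn_ψ₁ := Set.injOn_id _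
  injOn_ψ₂ := Set.injOn_id _
  edgeSet_disjoint := by
    rw [sideGraph_edgeSet hf₁, sideGraph_edgeSet hf₂, Set.image_id, Set.image_id]
    simpa [hf₁, hf₂] using hdisj
  edgeSet_eq := by
    rw [sideGraph_edgeSet hf₁, sideGraph_edgeSet hf₂, Set.image_id, Set.image_id,
      Set.insert_sdiff_self_of_notMem hf₁, Set.insert_sdiff_self_of_notMem hf₂]
    refine subset_antisymm (fun e he ↦ ?_)
      (Set.union_subset (G.edgesWithin_subset A) (G.edgesWithin_subset B))
    obtain ⟨x, y, hxy⟩ := exists_isLink_of_mem_edgeSet he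
    exact (h.cross x y hxy.adj).imp (⟨x, y, hxy, ·⟩) (⟨x, y, hxy, ·⟩)
  map_isLink₁ := by
    rintro e ⟨-, he⟩ x y (⟨-, h, -⟩ | ⟨h, -⟩)
    exacts [h, (he h).elim]
  map_isLink₂ := by
    rintro e ⟨-, he⟩ x y (⟨-, h, -⟩ | ⟨h, -⟩)
    exacts [h, (he h).elim]

lemma exists_isTwoSep (hu : u ∈ G.vertexSet) (hv : v ∈ G.vertexSet) (huv : u ≠ v)
    (hne : ((G.vertexSet \ {u}) \ {v}).Nonempty)
    (hc : ¬ ConnOn G.Adj ((G.vertexSet \ {u}) \ {v})) :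
    ∃ A B, IsTwoSep G.Adj A B u v ∧ A ∪ B = G.vertexSet ∧ A ⊂ G.vertexSet ∧ B ⊂ G.vertexSet := by
  obtain ⟨P, hP, ⟨a, ha, hPa⟩, b, hb, hPb⟩ : ∃ P : α → Prop,
      (∀ x ∈ (G.vertexSet \ {u}) \ {v}, ∀ y ∈ (G.vertexSet \ {u}) \ {v},
        G.Adj x y → P x → P y) ∧
      (∃ x ∈ (G.vertexSet \ {u}) \ {v}, P x) ∧ ∃ y ∈ (G.vertexSet \ {u}) \ {v}, ¬ P y := by
    by_contra! hcon
    exact hc ⟨hne, fun P hP hx y hy ↦ hcon P hP hx y hy⟩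
  simp only [Set.mem_sdiff, Set.mem_singleton_iff] at hP ha hb
  refine ⟨{x ∈ G.vertexSet | P x ∨ x = u ∨ x = v}, {x ∈ G.vertexSet | ¬ P x ∨ x = u ∨ x = v},
    ⟨fun x y h ↦ h.symm, huv, fun x ↦ ?_, fun x y hxy ↦ ?_⟩, ?_, ?_, ?_⟩
  · simp only [Set.mem_ofPred_eq]
    constructor
    · tauto
    · rintro (rfl | rfl) <;> tauto
  · have h1 := hP x
    have h2 := hP y
    have hx := hxy.left_mem
    have hy := hxy.right_mem
    have h3 := hxy.symm
    simp only [Set.mem_ofPred_eq]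
    grind
  · ext x
    simp only [Set.mem_ofPred_eq, Set.mem_union]
    tauto
  · exact ⟨fun x hx ↦ hx.1, fun h ↦ by have := (h hb.1.1).2; tauto⟩
  · exact ⟨fun x hx ↦ hx.1, fun h ↦ by have := (h ha.1.1).2; tauto⟩

/-- A 2-connected graph on at least three vertices that satisfies the equalities is obtained from
`K_4`: it is split along 2-separations until no two vertices separate. -/
theorem UnitSpade.obtainedFromCompleteFour (n : ℕ) :
    ∀ G : Graph α β, G.vertexSet.ncard = n → G.vertexSet.Finite → G.edgeSet.Finite →
      G.IsTwoConnected → G.UnitSpade → 3 ≤ G.vertexSet.ncard →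
      ObtainedFromCompleteFour 2 G := by
  induction n using Nat.strong_induction_on with
  | _ n ih =>
    intro G hn hV hE hG hs h3
    by_cases hc : ∀ x ∈ G.vertexSet, ∀ y ∈ G.vertexSet \ {x},
        ConnOn G.Adj ((G.vertexSet \ {x}) \ {y})
    · exact .base (hs.isCompleteFour hV hE hG h3 hc)
    push Not at hc
    obtain ⟨u, hu, v, hv, hc⟩ := hc
    have huv : u ≠ v := fun h ↦ hv.2 h.symm
    have hne : ((G.vertexSet \ {u}) \ {v}).Nonempty := by
      have h1 := Set.ncard_sdiff_singleton_add_one hu hV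
      have h2 := Set.ncard_sdiff_singleton_add_one hv (hV.subset Set.sdiff_subset)
      exact Set.nonempty_of_ncard_ne_zero (by omega)
    obtain ⟨A, B, hsep, hAB, hA, hB⟩ := exists_isTwoSep hu hv.1 huv hne hc
    have hAf := hV.subset hA.1
    have hBf := hV.subset hB.1
    have huAB := (hsep.inter u).2 (.inl rfl)
    have hvAB := (hsep.inter v).2 (.inr rfl)
    have hint : A ∩ B = {u, v} := Set.ext hsep.inter
    have hcard := Set.ncard_union_add_ncard_inter A B hAf hBf
    rw [hAB, hint, Set.ncard_pair huv] at hcard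
    have hAlt := Set.ncard_lt_ncard hA hV
    have hBlt := Set.ncard_lt_ncard hB hV
    -- The sparsity bound on both sides is attained, and leaves no edge from `u` to `v`.
    have hbA := hs.ncard_edgesWithin_le hV hE hG hA (by omega)
    have hbB := hs.ncard_edgesWithin_le hV hE hG hB (by omega)
    have hi := ncard_edgesWithin_add (X := A) (Y := B) hE (by
      intro x hxA hxB y hyB hyA hxy
      obtain h | h := hsep.cross x y hxy
      exacts [hyA h.2, hxB h.1])
    rw [hAB, edgesWithin_vertexSet, hs.1] at hi
    have hEf : ∀ S, (G.edgesWithin S).Finite := fun S ↦ hE.subset (G.edgesWithin_subset S)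
    have hzero : G.edgesWithin (A ∩ B) = ∅ := by
      rw [← Set.ncard_eq_zero (hEf _)]
      omega
    have hdisj : Disjoint (G.edgesWithin A) (G.edgesWithin B) := by
      rw [Set.disjoint_iff_inter_eq_empty, ← edgesWithin_inter, hzero]
    have hadj : ¬ G.Adj u v := fun ⟨e, he⟩ ↦ by
      have : e ∈ G.edgesWithin (A ∩ B) := ⟨u, v, he, huAB, hvAB⟩
      simp [hzero] at this
    -- The label of the additional edge of one side is taken from the other side.
    obtain ⟨f₂, hf₂A⟩ : (G.edgesWithin A).Nonempty := Set.nonempty_of_ncard_ne_zero (by omega)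
    obtain ⟨f₁, hf₁B⟩ : (G.edgesWithin B).Nonempty := Set.nonempty_of_ncard_ne_zero (by omega)
    have hf₁ : f₁ ∉ G.edgesWithin A := fun h ↦ Set.disjoint_left.1 hdisj h hf₁B
    have hf₂ : f₂ ∉ G.edgesWithin B := Set.disjoint_left.1 hdisj hf₂A
    let D := sideGluing hsep hAB hf₁ hf₂ hdisj huAB.1 hvAB.1 huAB.2 hvAB.2
    have hE₁ := sideGraph_edgeSet hf₁ huAB.1 hvAB.1
    have hE₂ := sideGraph_edgeSet hf₂ huAB.2 hvAB.2
    have hl₁ := sideGraph_loopless hG.loopless (f := f₁) huAB.1 hvAB.1 huv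
    have hl₂ := sideGraph_loopless hG.loopless (f := f₂) huAB.2 hvAB.2 huv
    have hG₁ := D.isTwoConnected_part₁ hl₁ hl₂ hG
    have hG₂ := D.swap.isTwoConnected_part₁ hl₂ hl₁ hG
    have hE₁f := hE₁ ▸ (hEf A).insert f₁
    have hE₂f := hE₂ ▸ (hEf B).insert f₂
    have hc₁ : (G.sideGraph A f₁ huAB.1 hvAB.1).edgeSet.ncard = 2 * (A.ncard - 1) := by
      rw [hE₁, Set.ncard_insert_of_notMem hf₁ (hEf A)]
      omega
    have hc₂ : (G.sideGraph B f₂ huAB.2 hvAB.2).edgeSet.ncard = 2 * (B.ncard - 1) := by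
      rw [hE₂, Set.ncard_insert_of_notMem hf₂ (hEf B)]
      omega
    have hs₁ := D.unitSpade_part₁ hG₁ hG₂ hAf hBf hE₁f hE₂f hs hc₁ hc₂ hadj
      (show 2 < B.ncard by omega)
    have hs₂ := D.swap.unitSpade_part₁ hG₂ hG₁ hBf hAf hE₂f hE₁f hs hc₂ hc₁ hadj
      (show 2 < A.ncard by omega)
    exact .step
      (ih A.ncard (by omega) _ rfl hAf hE₁f hG₁ hs₁ (show 3 ≤ A.ncard by omega))
      (ih B.ncard (by omega) _ rfl hBf hE₂f hG₂ hs₂ (show 3 ≤ B.ncard by omega))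
      ⟨hG₁, hG₂, f₁, D.isLink₁.edge_mem, f₂, D.isLink₂.edge_mem,
        ⟨fun _ ↦ 1, fun _ _ ↦ ⟨.inl rfl, fun _ ↦ rfl, fun _ ↦ rfl⟩, rfl⟩,
        ⟨fun _ ↦ 1, fun _ _ ↦ ⟨.inl rfl, fun _ ↦ rfl, fun _ ↦ rfl⟩, rfl⟩, ⟨D⟩⟩

end Split

lemma ObtainedFromCompleteFour.finite_unitSpade {α : Type u} {β : Type v} {G : Graph α β}
    (h : ObtainedFromCompleteFour 2 G) :
    G.vertexSet.Finite ∧ G.edgeSet.Finite ∧ G.UnitSpade := by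
  induction h with
  | base h => exact h.finite_unitSpade
  | step _ _ h ih₁ ih₂ =>
    obtain ⟨hG₁, hG₂, e₁, -, e₂, -, -, -, ⟨D⟩⟩ := h
    obtain ⟨hV₁, hE₁, hs₁⟩ := ih₁
    obtain ⟨hV₂, hE₂, hs₂⟩ := ih₂
    exact ⟨D.finite_vertexSet hV₁ hV₂, D.finite_edgeSet hE₁ hE₂,
      D.unitSpade hG₁ hG₂ hV₁ hV₂ hE₁ hE₂ hs₁ hs₂⟩

end Graph

theorem mainTheorem3 {α β : Type*} (G : Graph α β)
    (hV : G.vertexSet.Finite) (hE : G.edgeSet.Finite) (hG : G.IsTwoConnected) :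
    (G.Spade 2 ↔ G.IsTwoCycle ∨ Graph.ObtainedFromCompleteFour 2 G) ∧
    (G.Spade 2 → ¬ G.IsTwoCycle → G.Simple) := by
  have h2 : 1 < G.vertexSet.ncard := (Set.one_lt_ncard hV).2 hG.nontrivial
  have h3 : G.UnitSpade → ¬ G.IsTwoCycle → 3 ≤ G.vertexSet.ncard := fun hs hn ↦ by
    by_contra hlt
    exact hn (hs.isTwoCycle hG.loopless (by omega))
  rw [Graph.spade_two_iff hG hE]
  refine ⟨⟨fun hs ↦ ?_, fun h ↦ h.elim (·.unitSpade) (·.finite_unitSpade.2.2)⟩,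
    fun hs hn ↦ hs.simple hV hE hG (h3 hs hn)⟩
  by_cases hn : G.IsTwoCycle
  · exact .inl hn
  · exact .inr (Graph.UnitSpade.obtainedFromCompleteFour _ G rfl hV hE hG hs (h3 hs hn))
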